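/- Let $\delta,K_1,K_2,C_0,C_1$ be integers with $\delta\ge 3$, $1\le K_1\le K_2\le\delta$, $2\delta+2\le C_0,C_1\le 3\delta+2$, $C_0$ even and $C_1$ odd. Put $C=\min(C_0,C_1)$ and $C'=\max(C_0,C_1)$, and assume that the parameters are admissible, that is, one of the following cases holds. - Case II: $C\le 2\delta+K_1$, $C=2K_1+2K_2+1$, $K_1+K_2\ge\delta$, $K_1+2K_2\le 2\delta-1$, and either (IIA) $C'=C+1$, or (IIB) $C'>C+1$, $K_1=K_2$ and $3K_2=2\delta-1$. - Case III: $C>2\delta+K_1$, $K_1+2K_2\ge 2\delta-1$, $3K_2\ge 2\delta$; if $K_1+2K_2=2\delta-1$ then $C\ge 2\delta+K_1+2$; and if $C'>C+1$ then $C\ge 2\delta+K_2$. Let $\mathcal A^\delta_{K_1,K_2,C_0,C_1}$ be the class of finite metric spaces with integer distances at most $\delta$ such that every triangle of three distinct points, with perimeter $p$ and shortest side $m$, satisfies: if $p$ is odd then $2K_1<p<2K_2+2m$ and $p<C_1$; if $p$ is even then $p<C_0$. A $\delta$-edge-labelled graph is a finite simple graph with a label in $\{1,\dots,\delta\}$ on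 each edge; a homomorphism of such graphs maps edges to edges of the same label. Let $\mathcal G^\delta_{K_1,K_2,C_0,C_1}$ be the class of the $\delta$-edge-labelled graphs $(V,E,\ell)$ for which there is $(V,d)\in\mathcal A^\delta_{K_1,K_2,C_0,C_1}$ with $d|_E=\ell$. For a family $\mathcal F$ of $\delta$-edge-labelled cycles (of length at least $3$), let $\mathrm{Forb}(\mathcal F)$ be the class of the $\delta$-edge-labelled graphs to which no member of $\mathcal F$ has a homomorphism. The perimeter of a $\delta$-edge-labelled cycle is the sum of its labels. Such a cycle is called - non-metric if one of its labels is larger than the sum of all its other labels; - a $C$-cycle if, for some $n\ge 0$, its labels can be listed (in any order) as $d_0,\dots,d_{2n},x_1,\dots,x_k$ with $\sum_{i=0}^{2n} d_i>n(C-1)+\sum_{i=1}^k x_i$; - a $C_0$-cycle if its perimeter is even and, for some $n\in\{0,1\}$, its labels can be listed as $d_0,\dots,d_{2n},x_1,\dots,x_k$ with $\sum_{i=0}^{2n} d_i>n(C_0-1)+\sum_{i=1}^k x_i$; - a $C_1$-cycle if its perimeter is odd and, for some $n\in\{0,1\}$, its labels can be listed as $d_0,\dots,d_{2n},x_1,\dots,x_k$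 with $\sum_{i=0}^{2n} d_i>n(C_1-1)+\sum_{i=1}^k x_i$; - a $K_1$-cycle if it is not non-metric and its perimeter is odd and less than $2K_1$; - a $K_2$-cycle if its perimeter is odd and, for some $n\ge 0$, its labels can be listed as $d_1,\dots,d_{2n+2},x_1,\dots,x_k$ with $\sum_{i=1}^{2n+2} d_i>2K_2+n(C-1)+\sum_{i=1}^k x_i$. (Here $k\ge 0$.) Then $\mathcal G^\delta_{K_1,K_2,C_0,C_1}=\mathrm{Forb}(\mathcal F)$, where 1. if $|C_0-C_1|=1$, $\mathcal F$ consists of all non-metric cycles, $C$-cycles, $K_1$-cycles and $K_2$-cycles; 2. if $|C_0-C_1|>1$ and either $\delta>5$ or the parameters are in Case III, $\mathcal F$ consists of all non-metric cycles, $C_0$-cycles, $C_1$-cycles, $K_1$-cycles and $K_2$-cycles; 3. if $|C_0-C_1|>1$, $\delta=5$ and the parameters are in Case IIB, $\mathcal F$ consists of all non-metric cycles, $C_0$-cycles, $C_1$-cycles, $K_1$-cycles and $K_2$-cycles together with the single cycle $(5,5,5,5,5)$. -/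

import Mathlib

/-- The parameters are *acceptable*. -/
structure Acceptable (δ K₁ K₂ C₀ C₁ : ℕ) : Prop where
  three_le : 3 ≤ δ
  one_le_K₁ : 1 ≤ K₁
  K₁_le_K₂ : K₁ ≤ K₂
  K₂_le : K₂ ≤ δ
  le_C₀ : 2 * δ + 2 ≤ C₀
  C₀_le : C₀ ≤ 3 * δ + 2
  le_C₁ : 2 * δ + 2 ≤ C₁
  C₁_le : C₁ ≤ 3 * δ + 2
  even_C₀ : Even C₀
  odd_C₁ : Odd C₁

/-- The conditions common to Cases IIA and IIB, with `C = min C₀ C₁`. -/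
def CaseII (δ K₁ K₂ C₀ C₁ : ℕ) : Prop :=
  min C₀ C₁ ≤ 2 * δ + K₁ ∧
  min C₀ C₁ = 2 * K₁ + 2 * K₂ + 1 ∧
  δ ≤ K₁ + K₂ ∧
  K₁ + 2 * K₂ ≤ 2 * δ - 1

/-- Case IIA, with `C = min C₀ C₁` and `C' = max C₀ C₁`. -/
def CaseIIA (δ K₁ K₂ C₀ C₁ : ℕ) : Prop :=
  CaseII δ K₁ K₂ C₀ C₁ ∧ max C₀ C₁ = min C₀ C₁ + 1

/-- Case IIB, with `C = min C₀ C₁` and `C' = max C₀ C₁`. -/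
def CaseIIB (δ K₁ K₂ C₀ C₁ : ℕ) : Prop :=
  CaseII δ K₁ K₂ C₀ C₁ ∧ min C₀ C₁ + 1 < max C₀ C₁ ∧ K₁ = K₂ ∧ 3 * K₂ = 2 * δ - 1

/-- Case III, with `C = min C₀ C₁` and `C' = max C₀ C₁`. -/
def CaseIII (δ K₁ K₂ C₀ C₁ : ℕ) : Prop :=
  2 * δ + K₁ < min C₀ C₁ ∧
  2 * δ - 1 ≤ K₁ + 2 * K₂ ∧
  2 * δ ≤ 3 * K₂ ∧
  (K₁ + 2 * K₂ = 2 * δ - 1 → 2 * δ + K₁ + 2 ≤ min C₀ C₁) ∧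
  (min C₀ C₁ + 1 < max C₀ C₁ → 2 * δ + K₂ ≤ min C₀ C₁)

/-- The parameters are *admissible*: acceptable and in one of the Cases IIA, IIB, III. -/
def Admissible (δ K₁ K₂ C₀ C₁ : ℕ) : Prop :=
  Acceptable δ K₁ K₂ C₀ C₁ ∧
    (CaseIIA δ K₁ K₂ C₀ C₁ ∨ CaseIIB δ K₁ K₂ C₀ C₁ ∨ CaseIII δ K₁ K₂ C₀ C₁)

/-- A `δ`-edge-labelled graph on the vertex set `V`: a graph together with a labelling of its
edges by elements of `{1, …, δ}`. -/
structure EdgeLabelledGraph (δ : ℕ) (V : Type*) where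
  graph : SimpleGraph V
  label : graph.EdgeLabeling (Set.Icc 1 δ)

/-- A homomorphism of `δ`-edge-labelled graphs: edges go to edges of the same label. -/
def EdgeLabelledGraph.IsHom {δ : ℕ} {W V : Type*} (F : EdgeLabelledGraph δ W)
    (G : EdgeLabelledGraph δ V) (f : W → V) : Prop :=
  ∀ u v, ∀ h : F.graph.Adj u v, ∃ h' : G.graph.Adj (f u) (f v),
    G.label.get (f u) (f v) h' = F.label.get u v h

/-- `(V, d)` is a metric space with integer distances, all at most `δ`, whose triangles satisfy
the constraints given by `K₁, K₂, C₀, C₁`. -/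
structure InClassA (δ K₁ K₂ C₀ C₁ : ℕ) {V : Type*} (d : V → V → ℕ) : Prop where
  eq_zero_iff : ∀ u v, d u v = 0 ↔ u = v
  symm : ∀ u v, d u v = d v u
  triangle : ∀ u v w, d u w ≤ d u v + d v w
  le_diam : ∀ u v, d u v ≤ δ
  odd_K : ∀ u v w, u ≠ v → v ≠ w → u ≠ w → Odd (d u v + d u w + d v w) →
    2 * K₁ < d u v + d u w + d v w ∧
    d u v + d u w + d v w < 2 * K₂ + 2 * min (d u v) (min (d u w) (d v w))
  odd_C₁ : ∀ u v w, u ≠ v → v ≠ w → u ≠ w → Odd (d u v + d u w + d v w) →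
    d u v + d u w + d v w < C₁
  even_C₀ : ∀ u v w, u ≠ v → v ≠ w → u ≠ w → Even (d u v + d u w + d v w) →
    d u v + d u w + d v w < C₀

/-- The `δ`-edge-labelled graphs on `V` that can be completed to a metric space satisfying the
constraints (only used for finite `V`). -/
def completable (δ K₁ K₂ C₀ C₁ : ℕ) (V : Type*) : Set (EdgeLabelledGraph δ V) :=
  {G | ∃ d : V → V → ℕ, InClassA δ K₁ K₂ C₀ C₁ d ∧
    ∀ u v, ∀ h : G.graph.Adj u v, d u v = (G.label.get u v h : ℕ)}

/-- A `δ`-edge-labelled cycle with `extra + 3` edges: the vertices and the edges are indexed by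
`Fin (extra + 3)`, edge `i` joins the vertices `i` and `i + 1` (cyclically) and has label
`dist i`. Up to isomorphism, every `δ`-edge-labelled cycle is of this form. -/
structure LabelledCycle (δ : ℕ) where
  extra : ℕ
  dist : Fin (extra + 3) → Set.Icc 1 δ

namespace LabelledCycle

variable {δ : ℕ}

/-- The length of edge `i`, as a natural number. -/
def len (c : LabelledCycle δ) (i : Fin (c.extra + 3)) : ℕ := (c.dist i : ℕ)

/-- The perimeter of a cycle. -/
def perimeter (c : LabelledCycle δ) : ℕ := ∑ i, c.len i

/-- In a cycle with at least three vertices, exactly one of two adjacent vertices is the cyclic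
successor of the other. -/
theorem eq_succ_iff_of_adj {n : ℕ} {u v : Fin (n + 3)}
    (h : (SimpleGraph.cycleGraph (n + 3)).Adj u v) : v = u + 1 ↔ ¬ u = v + 1 := by
  rw [SimpleGraph.cycleGraph_adj, sub_eq_iff_eq_add', sub_eq_iff_eq_add'] at h
  constructor
  · rintro rfl h2
    have h3 : (1 + 1 : Fin (n + 3)) = 0 := by
      have : u + (1 + 1) = u + 0 := by rw [← add_assoc, ← h2, add_zero]
      exact add_left_cancel this
    have h4 := congrArg Fin.val h3
    simp only [Fin.val_add, Fin.val_one, Fin.val_zero] at h4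
    rw [Nat.mod_eq_of_lt (by omega)] at h4
    omega
  · intro h1
    rcases h with h | h
    · exact absurd h h1
    · exact h

/-- The `δ`-edge-labelled graph `(d_0, …, d_{k-1})` given by a labelled cycle. -/
def toGraph (c : LabelledCycle δ) : EdgeLabelledGraph δ (Fin (c.extra + 3)) where
  graph := SimpleGraph.cycleGraph (c.extra + 3)
  label := SimpleGraph.EdgeLabeling.mk
    (fun u v _ => if v = u + 1 then c.dist u else c.dist v)
    (fun u v h => by
      have := eq_succ_iff_of_adj h
      by_cases h1 : v = u + 1
      · rw [if_neg (this.1 h1), if_pos h1]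
      · rw [if_neg h1, if_pos (not_not.1 fun h2 => h1 (this.2 h2))])

/-- Non-metric cycles: one edge is longer than the sum of the other edges. -/
def nonMetric (δ : ℕ) : Set (LabelledCycle δ) :=
  {c | ∃ a, ∑ i ∈ {a}ᶜ, c.len i < c.len a}

/-- `C`-cycles, where `s` is the set of the edges `d_0, …, d_{2n}`. -/
def cCycles (δ C : ℕ) : Set (LabelledCycle δ) :=
  {c | ∃ (n : ℕ) (s : Finset (Fin (c.extra + 3))), s.card = 2 * n + 1 ∧
    n * (C - 1) + ∑ i ∈ sᶜ, c.len i < ∑ i ∈ s, c.len i}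

/-- `C₀`-cycles: as `C`-cycles, with `n ∈ {0, 1}` and even perimeter. -/
def c₀Cycles (δ C₀ : ℕ) : Set (LabelledCycle δ) :=
  {c | Even c.perimeter ∧ ∃ (n : ℕ) (s : Finset (Fin (c.extra + 3))), (n = 0 ∨ n = 1) ∧
    s.card = 2 * n + 1 ∧ n * (C₀ - 1) + ∑ i ∈ sᶜ, c.len i < ∑ i ∈ s, c.len i}

/-- `C₁`-cycles: as `C`-cycles, with `n ∈ {0, 1}` and odd perimeter. -/
def c₁Cycles (δ C₁ : ℕ) : Set (LabelledCycle δ) :=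
  {c | Odd c.perimeter ∧ ∃ (n : ℕ) (s : Finset (Fin (c.extra + 3))), (n = 0 ∨ n = 1) ∧
    s.card = 2 * n + 1 ∧ n * (C₁ - 1) + ∑ i ∈ sᶜ, c.len i < ∑ i ∈ s, c.len i}

/-- `K₁`-cycles: metric cycles of odd perimeter less than `2 * K₁`. -/
def k₁Cycles (δ K₁ : ℕ) : Set (LabelledCycle δ) :=
  {c | c ∉ nonMetric δ ∧ Odd c.perimeter ∧ c.perimeter < 2 * K₁}

/-- `K₂`-cycles, where `s` is the set of the edges `d_1, …, d_{2n+2}`. -/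
def k₂Cycles (δ K₂ C : ℕ) : Set (LabelledCycle δ) :=
  {c | Odd c.perimeter ∧ ∃ (n : ℕ) (s : Finset (Fin (c.extra + 3))), s.card = 2 * n + 2 ∧
    2 * K₂ + n * (C - 1) + ∑ i ∈ sᶜ, c.len i < ∑ i ∈ s, c.len i}

/-- The cycle `(5, 5, 5, 5, 5)` (as a one-element family, in `{1, …, δ}` with `5 ≤ δ`). -/
def fiveFives (δ : ℕ) : Set (LabelledCycle δ) :=
  {c | c.extra + 3 = 5 ∧ ∀ i, c.len i = 5}

end LabelledCycle

/-- The `δ`-edge-labelled graphs on `V` to which no member of the family `F` of `δ`-edge-labelled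
cycles has a homomorphism. -/
def Forb {δ : ℕ} (F : Set (LabelledCycle δ)) (V : Type*) : Set (EdgeLabelledGraph δ V) :=
  {G | ∀ c ∈ F, ¬ ∃ f : Fin (c.extra + 3) → V, c.toGraph.IsHom G f}

/-! Each cycle condition is a condition on closed walks whose labels are flagged: the flagged ones
play the `d_i`, the others the `x_i`.

Necessity. In a space of the class, a walk from `u` to `w` is folded, edge by edge, into the single
distance `d u w`. Most edges cost a triangle inequality, and every second flagged edge costs the
perimeter bound; carrying the parity along brings in `K₁` and `K₂` (the lemmas `IsDistWalk.*`). When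
`C` is large it is enough to cut a closed walk at its few flagged edges and to look at the resulting
triangle or quadrilateral.

Sufficiency. Walks impose upper and lower bounds on every distance, and the absence of non-metric
cycles or `C`-cycles says that no lower bound exceeds an upper one. The completion takes the median
of a constant `M`, the greatest lower bound and the least upper bound (`IsClamp`). A distance below
`M` is thus realised by an upper-bound walk and a distance above `M` by a lower-bound walk. In a
triangle that violates a constraint, the numerical conditions on `M` force the relevant sides
strictly to the correct side of `M`, and the walks of these sides glue to a contradiction.

There are three regimes. If `C₀` and `C₁` are consecutive, all perimeters are at most `C - 1`, and
this bound may be used inside the walks (`exists_inClassA_of_adjacent`). In Case III with a gap,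
purely metric bounds suffice (`exists_inClassA_of_large`). In Case IIB one takes `M = K₁ = K₂ = K`;
the default value `K` then fails exactly in triangles `(δ, δ, K)`, of odd perimeter `C₁`, and these
sides are lowered to `K - 1` (`exists_inClassA_of_caseIIB`). Two lowered sides together with a side
`5` are what makes the pentagon of fives an obstruction for `δ = 5`. -/

/-- `IsWalk R l u w`: the list `l` of flagged labels is read along a walk from `u` to `w`, where
`R u v ℓ` means that `u` and `v` are joined by an edge of label `ℓ`. -/
def IsWalk {V : Type*} (R : V → V → ℕ → Prop) : List (ℕ × Bool) → V → V → Prop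
  | [], u, w => u = w
  | e :: l, u, w => ∃ v, R u v e.1 ∧ IsWalk R l v w

/-- The sum of the labels that are not flagged. -/
def xsum (l : List (ℕ × Bool)) : ℕ := (l.map fun e => if e.2 then 0 else e.1).sum

/-- The sum of the flagged labels. -/
def dsum (l : List (ℕ × Bool)) : ℕ := (l.map fun e => if e.2 then e.1 else 0).sum

/-- The number of flagged labels. -/
def dcount (l : List (ℕ × Bool)) : ℕ := (l.map fun e => if e.2 then 1 else 0).sum

/-! ### Sums over flagged lists, and operations on walks -/

section Sums

variable (l m : List (ℕ × Bool)) (a : ℕ)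

@[simp] theorem xsum_nil : xsum [] = 0 := rfl
@[simp] theorem dsum_nil : dsum [] = 0 := rfl
@[simp] theorem dcount_nil : dcount [] = 0 := rfl
@[simp] theorem xsum_cons_true : xsum ((a, true) :: l) = xsum l := by simp [xsum]
@[simp] theorem dsum_cons_true : dsum ((a, true) :: l) = a + dsum l := by simp [dsum]
@[simp] theorem dcount_cons_true : dcount ((a, true) :: l) = 1 + dcount l := by simp [dcount]
@[simp] theorem xsum_cons_false : xsum ((a, false) :: l) = a + xsum l := by simp [xsum]
@[simp] theorem dsum_cons_false : dsum ((a, false) :: l) = dsum l := by simp [dsum]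
@[simp] theorem dcount_cons_false : dcount ((a, false) :: l) = dcount l := by simp [dcount]
@[simp] theorem xsum_append : xsum (l ++ m) = xsum l + xsum m := by simp [xsum]
@[simp] theorem dsum_append : dsum (l ++ m) = dsum l + dsum m := by simp [dsum]
@[simp] theorem dcount_append : dcount (l ++ m) = dcount l + dcount m := by simp [dcount]
@[simp] theorem xsum_reverse : xsum l.reverse = xsum l := by simp [xsum, List.sum_reverse]
@[simp] theorem dsum_reverse : dsum l.reverse = dsum l := by simp [dsum, List.sum_reverse]
@[simp] theorem dcount_reverse : dcount l.reverse = dcount l := by simp [dcount, List.sum_reverse]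

theorem exists_flagged_of_dcount_pos (l : List (ℕ × Bool)) (h : 0 < dcount l) :
    ∃ A d B, l = A ++ (d, true) :: B ∧ dcount A = 0 := by
  induction l with
  | nil => simp at h
  | cons e l ih =>
    obtain ⟨a, _ | _⟩ := e
    · obtain ⟨A, d, B, rfl, hA⟩ := ih (by simpa using h)
      exact ⟨(a, false) :: A, d, B, rfl, by simpa using hA⟩
    · exact ⟨[], a, l, rfl, rfl⟩

theorem dsum_eq_zero_of_dcount (h : dcount l = 0) : dsum l = 0 := by
  induction l with
  | nil => rfl
  | cons e l ih =>
    obtain ⟨a, _ | _⟩ := e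
    · simpa using ih (by simpa using h)
    · simp at h

end Sums

namespace IsWalk

variable {V : Type*} {R : V → V → ℕ → Prop}

theorem append {l m : List (ℕ × Bool)} {u v w : V} (h : IsWalk R l u v) (h' : IsWalk R m v w) :
    IsWalk R (l ++ m) u w := by
  induction l generalizing u with
  | nil => cases h; exact h'
  | cons e l ih => obtain ⟨x, hx, h⟩ := h; exact ⟨x, hx, ih h⟩

theorem exists_of_append {l m : List (ℕ × Bool)} {u w : V} (h : IsWalk R (l ++ m) u w) :
    ∃ v, IsWalk R l u v ∧ IsWalk R m v w := by
  induction l generalizing u with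
  | nil => exact ⟨u, rfl, h⟩
  | cons e l ih =>
    obtain ⟨x, hx, h⟩ := h
    obtain ⟨v, h1, h2⟩ := ih h
    exact ⟨v, ⟨x, hx, h1⟩, h2⟩

theorem reverse (hR : ∀ u v ℓ, R u v ℓ → R v u ℓ) {l : List (ℕ × Bool)} {u w : V}
    (h : IsWalk R l u w) : IsWalk R l.reverse w u := by
  induction l generalizing u with
  | nil => cases h; rfl
  | cons e l ih =>
    obtain ⟨x, hx, h⟩ := h
    rw [List.reverse_cons]
    exact (ih h).append ⟨u, hR _ _ _ hx, rfl⟩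

theorem mono {R' : V → V → ℕ → Prop} (hR : ∀ u v ℓ, R u v ℓ → R' u v ℓ) {l : List (ℕ × Bool)}
    {u w : V} (h : IsWalk R l u w) : IsWalk R' l u w := by
  induction l generalizing u with
  | nil => exact h
  | cons e l ih => obtain ⟨x, hx, h⟩ := h; exact ⟨x, hR _ _ _ hx, ih h⟩

theorem dsum_le {δ : ℕ} (hR : ∀ u v ℓ, R u v ℓ → ℓ ≤ δ) {l : List (ℕ × Bool)} {u w : V}
    (h : IsWalk R l u w) : dsum l ≤ dcount l * δ := by
  induction l generalizing u with
  | nil => simp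
  | cons e l ih =>
    obtain ⟨x, hx, h⟩ := h
    have := ih h
    have := hR _ _ _ hx
    obtain ⟨a, _ | _⟩ := e
    · simpa
    · simp only [dsum_cons_true, dcount_cons_true, add_mul, one_mul] at *
      omega

theorem map_range (n : ℕ) (p : ℕ → V) (lab : ℕ → ℕ × Bool)
    (h : ∀ i < n, R (p i) (p (i + 1)) (lab i).1) :
    IsWalk R ((List.range n).map lab) (p 0) (p n) := by
  induction n with
  | zero => rfl
  | succ n ih =>
    rw [List.range_succ, List.map_append]
    exact (ih fun i hi => h i (by omega)).append ⟨_, h n (by omega), rfl⟩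

theorem exists_map_range {l : List (ℕ × Bool)} {u w : V} (h : IsWalk R l u w) :
    ∃ (p : ℕ → V) (lab : ℕ → ℕ × Bool), p 0 = u ∧ p l.length = w ∧
      (∀ i < l.length, R (p i) (p (i + 1)) (lab i).1) ∧ (List.range l.length).map lab = l := by
  induction l generalizing u with
  | nil => exact ⟨fun _ => u, fun _ => (0, false), rfl, h, by simp, rfl⟩
  | cons e l ih =>
    obtain ⟨v, hv, h⟩ := h
    obtain ⟨p, lab, h0, hn, hp, hl⟩ := ih h
    refine ⟨fun i => Nat.casesOn i u p, fun i => Nat.casesOn i e lab, rfl, hn, ?_, ?_⟩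
    · rintro (_ | i) hi
      · simpa [h0] using hv
      · exact hp i (by simpa using hi)
    · rw [List.length_cons, List.range_succ_eq_map, List.map_cons, List.map_map]
      congr 1

end IsWalk

theorem sum_map_range {M : Type*} [AddCommMonoid M] (n : ℕ) (f : ℕ → M) :
    ((List.range n).map f).sum = ∑ i : Fin n, f i := by
  rw [← Finset.sum_range]; rfl

/-! ### Homomorphic images of cycles as closed walks -/

namespace EdgeLabelledGraph

variable {δ : ℕ} {V : Type*}

/-- `u` and `v` are joined by an edge of label `ℓ`. -/
def HasEdge (G : EdgeLabelledGraph δ V) (u v : V) (ℓ : ℕ) : Prop :=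
  ∃ h : G.graph.Adj u v, (G.label.get u v h : ℕ) = ℓ

variable {G : EdgeLabelledGraph δ V} {u v : V} {k ℓ : ℕ}

theorem HasEdge.symm (h : G.HasEdge u v ℓ) : G.HasEdge v u ℓ := by
  obtain ⟨h, rfl⟩ := h
  exact ⟨h.symm, by rw [G.label.get_comm]⟩

theorem HasEdge.mem (h : G.HasEdge u v ℓ) : 1 ≤ ℓ ∧ ℓ ≤ δ := by
  obtain ⟨h, rfl⟩ := h
  exact (G.label.get u v h).2

theorem HasEdge.unique (h : G.HasEdge u v ℓ) (h' : G.HasEdge u v k) : ℓ = k := by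
  obtain ⟨h, rfl⟩ := h
  obtain ⟨h', rfl⟩ := h'
  rfl

theorem HasEdge.ne (h : G.HasEdge u v ℓ) : u ≠ v := h.1.ne

end EdgeLabelledGraph

namespace LabelledCycle

variable {δ : ℕ} {V : Type*}

theorem toGraph_label_succ (c : LabelledCycle δ) (u v : Fin (c.extra + 3))
    (h : c.toGraph.graph.Adj u v) (e : v = u + 1) : c.toGraph.label.get u v h = c.dist u := by
  have : c.toGraph.label.get u v h = if v = u + 1 then c.dist u else c.dist v := rfl
  rw [this, if_pos e]

theorem isHom_iff (c : LabelledCycle δ) (G : EdgeLabelledGraph δ V) (f : Fin (c.extra + 3) → V) :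
    c.toGraph.IsHom G f ↔ ∀ i, G.HasEdge (f i) (f (i + 1)) (c.len i) := by
  constructor
  · intro h i
    have hadj : c.toGraph.graph.Adj i (i + 1) := by
      change (SimpleGraph.cycleGraph (c.extra + 3)).Adj i (i + 1)
      rw [SimpleGraph.cycleGraph_adj]
      right; simp
    obtain ⟨h', e⟩ := h i (i + 1) hadj
    exact ⟨h', by rw [e, toGraph_label_succ _ _ _ _ rfl]; rfl⟩
  · have key : (∀ i, G.HasEdge (f i) (f (i + 1)) (c.len i)) → ∀ u v,
        ∀ h : c.toGraph.graph.Adj u v, v = u + 1 → G.HasEdge (f u) (f v)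
          (c.toGraph.label.get u v h) := by
      intro h u v huv e
      rw [toGraph_label_succ _ _ _ _ e, e]
      exact h u
    intro h u v huv
    have huv' : (SimpleGraph.cycleGraph (c.extra + 3)).Adj u v := huv
    rw [SimpleGraph.cycleGraph_adj, sub_eq_iff_eq_add', sub_eq_iff_eq_add'] at huv'
    suffices H : G.HasEdge (f u) (f v) (c.toGraph.label.get u v huv) by
      obtain ⟨h', e⟩ := H
      exact ⟨h', Subtype.ext e⟩
    rcases huv' with e | e
    · have := (key h v u huv.symm e).symm
      rwa [SimpleGraph.EdgeLabeling.get_comm] at this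
    · exact key h u v huv e

/-- A flagged homomorphic image of a cycle is a closed walk. -/
theorem exists_isWalk_of_isHom (c : LabelledCycle δ) (G : EdgeLabelledGraph δ V)
    (f : Fin (c.extra + 3) → V) (hf : c.toGraph.IsHom G f) (s : Finset (Fin (c.extra + 3))) :
    ∃ u l, IsWalk G.HasEdge l u u ∧ dcount l = s.card ∧ dsum l = ∑ i ∈ s, c.len i ∧
      xsum l = ∑ i ∈ sᶜ, c.len i ∧ xsum l + dsum l = c.perimeter := by
  rw [isHom_iff] at hf
  have hsucc (i : ℕ) : Fin.ofNat (c.extra + 3) (i + 1) = Fin.ofNat (c.extra + 3) i + 1 := by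
    ext; simp [Fin.val_add]
  have hval (i : Fin (c.extra + 3)) : Fin.ofNat (c.extra + 3) i = i := by
    ext; simp
  have h := IsWalk.map_range (R := G.HasEdge) (c.extra + 3)
    (fun i => f (Fin.ofNat _ i))
    (fun i => (c.len (Fin.ofNat _ i), decide (Fin.ofNat _ i ∈ s)))
    (fun i _ => by
      simp only [hsucc]
      exact hf _)
  have hz : Fin.ofNat (c.extra + 3) (c.extra + 3) = Fin.ofNat (c.extra + 3) 0 := by
    ext; simp
  simp only [hz] at h
  have h1 : dsum ((List.range (c.extra + 3)).map fun i : ℕ =>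
      (c.len (Fin.ofNat _ i), decide (Fin.ofNat _ i ∈ s))) = ∑ i ∈ s, c.len i := by
    rw [dsum, List.map_map, sum_map_range]
    simp [Finset.sum_ite_mem]
  have h2 : xsum ((List.range (c.extra + 3)).map fun i : ℕ =>
      (c.len (Fin.ofNat _ i), decide (Fin.ofNat _ i ∈ s))) = ∑ i ∈ sᶜ, c.len i := by
    rw [xsum, List.map_map, sum_map_range]
    simp only [Function.comp_apply, hval, decide_eq_true_eq]
    rw [← Finset.sum_compl_add_sum s, Finset.sum_eq_zero (s := s) (by simp_all), add_zero]
    exact Finset.sum_congr rfl fun i hi => by simp_all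
  refine ⟨_, _, h, ?_, h1, h2, ?_⟩
  · rw [dcount, List.map_map, sum_map_range]
    simp
  · rw [h1, h2]
    exact Finset.sum_compl_add_sum s _

/-- A closed walk of length at least three is a flagged homomorphic image of a cycle. -/
theorem exists_isHom_of_isWalk (G : EdgeLabelledGraph δ V) {u : V} {l : List (ℕ × Bool)}
    (h : IsWalk G.HasEdge l u u) (h3 : 3 ≤ l.length) :
    ∃ (c : LabelledCycle δ) (f : Fin (c.extra + 3) → V) (s : Finset (Fin (c.extra + 3))),
      c.toGraph.IsHom G f ∧ s.card = dcount l ∧ ∑ i ∈ s, c.len i = dsum l ∧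
      ∑ i ∈ sᶜ, c.len i = xsum l ∧ c.perimeter = xsum l + dsum l ∧ c.extra + 3 = l.length ∧
      ∀ i, ∃ b, (c.len i, b) ∈ l := by
  obtain ⟨p, lab, h0, hn, hp, hl⟩ := h.exists_map_range
  obtain ⟨m, hm⟩ : ∃ m, l.length = m + 3 := ⟨l.length - 3, by omega⟩
  rw [hm] at hn hp hl
  let c : LabelledCycle δ := ⟨m, fun i => ⟨(lab i).1, (hp i i.2).mem⟩⟩
  let s : Finset (Fin (c.extra + 3)) :=
    Finset.univ.filter fun i : Fin (m + 3) => (lab i).2 = true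
  have hlen : ∀ i : Fin (m + 3), c.len i = (lab i).1 := fun _ => rfl
  have hs : ∀ i : Fin (m + 3), i ∈ s ↔ (lab i).2 = true := fun i => by simp [s]
  have h1 : ∑ i ∈ s, c.len i = dsum l := by
    rw [← hl, dsum, List.map_map, sum_map_range, ← Finset.sum_compl_add_sum s,
      Finset.sum_eq_zero (s := sᶜ), zero_add]
    · exact Finset.sum_congr rfl fun i hi => by simp [(hs i).1 hi, hlen]
    · intro i hi
      rw [Finset.mem_compl, hs] at hi
      simp [hi]
  have h2 : ∑ i ∈ sᶜ, c.len i = xsum l := by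
    rw [← hl, xsum, List.map_map, sum_map_range, ← Finset.sum_compl_add_sum s,
      Finset.sum_eq_zero (s := s), add_zero]
    · refine Finset.sum_congr rfl fun i hi => ?_
      rw [Finset.mem_compl, hs] at hi
      simp [hi, hlen]
    · intro i hi
      rw [hs] at hi
      simp [hi]
  refine ⟨c, fun i => p i, s, ?_, ?_, h1, h2, ?_, hm.symm, ?_⟩
  · rw [isHom_iff]
    intro i
    have := hp i i.2
    rcases eq_or_ne i (Fin.last (m + 2)) with rfl | hi
    · have e : p ((Fin.last (m + 2) : Fin (m + 3)) + 1 : Fin (m + 3)) = p (m + 2 + 1) := by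
        rw [Fin.last_add_one]
        change p 0 = p (m + 3)
        rw [h0, hn]
      rw [e]
      exact this
    · have e : ((i + 1 : Fin (m + 3)) : ℕ) = i + 1 :=
        Fin.val_add_one_of_lt (Fin.lt_last_iff_ne_last.2 hi)
      rw [e]
      exact this
  · rw [← hl, dcount, List.map_map, sum_map_range, Finset.card_eq_sum_ones,
      Finset.sum_filter]
    rfl
  · rw [← h1, ← h2]
    exact (Finset.sum_compl_add_sum s _).symm
  · intro i
    refine ⟨(lab i).2, ?_⟩
    rw [← hl, List.mem_map]
    exact ⟨i, List.mem_range.2 i.2, rfl⟩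

end LabelledCycle

/-! ### Triangle constraints without distinctness assumptions -/

namespace InClassA

variable {δ K₁ K₂ C₀ C₁ : ℕ} {V : Type*} {d : V → V → ℕ}

theorem self (h : InClassA δ K₁ K₂ C₀ C₁ d) (u : V) : d u u = 0 := (h.eq_zero_iff u u).2 rfl

theorem odd_triangle (h : InClassA δ K₁ K₂ C₀ C₁ d) (u v w : V)
    (ho : (d u v + d v w + d u w) % 2 = 1) :
    2 * K₁ < d u v + d v w + d u w ∧ d u v + d v w + d u w < C₁ ∧
    d u v + d v w < 2 * K₂ + d u w ∧ d u v + d u w < 2 * K₂ + d v w ∧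
    d v w + d u w < 2 * K₂ + d u v := by
  have hs := h.symm
  have h0 := h.self
  have huv : u ≠ v := by rintro rfl; rw [h0] at ho; omega
  have hvw : v ≠ w := by rintro rfl; rw [h0] at ho; omega
  have huw : u ≠ w := by rintro rfl; rw [h0, hs v u] at ho; omega
  have ho' : Odd (d u v + d u w + d v w) := Nat.odd_iff.2 (by omega)
  obtain ⟨h1, h2⟩ := h.odd_K u v w huv hvw huw ho'
  have h3 := h.odd_C₁ u v w huv hvw huw ho'
  omega

theorem even_triangle (h : InClassA δ K₁ K₂ C₀ C₁ d) (hC₀ : 2 * δ + 2 ≤ C₀) (u v w : V)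
    (he : (d u v + d v w + d u w) % 2 = 0) : d u v + d v w + d u w < C₀ := by
  have hs := h.symm
  have h0 := h.self
  have h1 := h.le_diam u v
  have h2 := h.le_diam u w
  have h3 := h.le_diam v w
  rcases eq_or_ne u v with rfl | huv
  · rw [h0]; omega
  rcases eq_or_ne v w with rfl | hvw
  · rw [h0]; omega
  rcases eq_or_ne u w with rfl | huw
  · rw [h0]; omega
  have := h.even_C₀ u v w huv hvw huw (Nat.even_iff.2 (by omega))
  omega

end InClassA

/-! ### Necessity: walks in a space of the class -/

section DistWalk

variable {V : Type*} {d : V → V → ℕ}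

/-- Walks in the complete graph whose edges are labelled by `d`. -/
abbrev IsDistWalk (d : V → V → ℕ) : List (ℕ × Bool) → V → V → Prop :=
  IsWalk fun u v ℓ => d u v = ℓ

/-- Induction on the walk. Prepending an unflagged edge, or a flagged edge to an even number of
flags, uses the triangle inequality; a flagged edge that completes a pair uses the perimeter bound
`N`. For a closed walk with an odd number of flags this excludes `C`-cycles with `N = C - 1`. -/
theorem IsDistWalk.bound {N : ℕ} (h0 : ∀ u, d u u = 0) (hs : ∀ u v, d u v = d v u)
    (ht : ∀ u v w, d u w ≤ d u v + d v w) (hp : ∀ u v w, d u v + d v w + d u w ≤ N)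
    {l : List (ℕ × Bool)} {u w : V} (h : IsDistWalk d l u w) :
    ∀ n, (dcount l = 2 * n → d u w + dsum l ≤ n * N + xsum l) ∧
      (dcount l = 2 * n + 1 → dsum l ≤ n * N + xsum l + d u w) := by
  induction l generalizing u with
  | nil => cases h; simp [h0]
  | cons e l ih =>
    obtain ⟨v, hv, h⟩ := h
    have ih := ih h
    have h1 := ht u v w
    have h2 := hp u v w
    have h3 := ht v u w
    have h4 := ht u w v
    have h5 := hs v u
    have h6 := hs w v
    obtain ⟨a, _ | _⟩ := e <;> intro n <;> obtain ⟨ih1, ih2⟩ := ih n <;> simp only [] at hv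
    · simp only [xsum_cons_false, dsum_cons_false, dcount_cons_false]
      constructor <;> intro hn
      · have := ih1 hn; omega
      · have := ih2 hn; omega
    · simp only [xsum_cons_true, dsum_cons_true, dcount_cons_true]
      constructor <;> intro hn
      · obtain _ | n := n
        · omega
        have := (ih n).2 (by omega)
        rw [show (n + 1) * N = n * N + N from Nat.succ_mul n N]
        omega
      · have := ih1 (by omega); omega

theorem IsDistWalk.parity_or_K₁ {K₁ : ℕ} (h0 : ∀ u, d u u = 0) (hs : ∀ u v, d u v = d v u)
    (ht : ∀ u v w, d u w ≤ d u v + d v w)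
    (hodd : ∀ u v w, (d u v + d v w + d u w) % 2 = 1 → 2 * K₁ < d u v + d v w + d u w)
    {l : List (ℕ × Bool)} {u w : V} (h : IsDistWalk d l u w) :
    d u w ≤ xsum l + dsum l ∧ ((xsum l + dsum l + d u w) % 2 = 0 ∨
      2 * K₁ < xsum l + dsum l + d u w) := by
  induction l generalizing u with
  | nil => cases h; simp [h0]
  | cons e l ih =>
    obtain ⟨v, hv, h⟩ := h
    have ih := ih h
    have h1 := ht u v w
    have h2 := hodd u v w
    have h3 := ht v u w
    have h5 := hs v u
    obtain ⟨a, _ | _⟩ := e <;> simp only [] at hv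
    · simp only [xsum_cons_false, dsum_cons_false]
      omega
    · simp only [xsum_cons_true, dsum_cons_true]
      omega

/-- In the antipodal double cover an odd closed walk has length more than `2 * K₁`. -/
theorem IsDistWalk.parity_or_antipodal {K₁ K₂ N : ℕ} (hN : N = 2 * K₁ + 2 * K₂)
    (h0 : ∀ u, d u u = 0) (hs : ∀ u v, d u v = d v u) (ht : ∀ u v w, d u w ≤ d u v + d v w)
    (hp : ∀ u v w, d u v + d v w + d u w ≤ N)
    (hodd : ∀ u v w, (d u v + d v w + d u w) % 2 = 1 → 2 * K₁ < d u v + d v w + d u w ∧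
      d u v + d v w < 2 * K₂ + d u w ∧ d u v + d u w < 2 * K₂ + d v w ∧
      d v w + d u w < 2 * K₂ + d u v)
    {l : List (ℕ × Bool)} {u w : V} (h : IsDistWalk d l u w) :
    ∀ n, (dcount l = 2 * n → (xsum l + dsum l + d u w) % 2 = 0 ∨
        2 * K₁ + dsum l < n * N + xsum l + d u w) ∧
      (dcount l = 2 * n + 1 → (xsum l + dsum l + d u w) % 2 = 0 ∨
        dsum l + d u w < n * N + 2 * K₂ + xsum l) := by
  induction l generalizing u with
  | nil => cases h; simp [h0]
  | cons e l ih =>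
    obtain ⟨v, hv, h⟩ := h
    have ih := ih h
    have hb := IsDistWalk.bound h0 hs ht hp h
    have h1 := ht u v w
    have h2 := hodd u v w
    have h2' := hp u v w
    have h3 := ht v u w
    have h4 := ht u w v
    have h5 := hs v u
    have h6 := hs w v
    obtain ⟨a, _ | _⟩ := e <;> intro n <;> obtain ⟨ih1, ih2⟩ := ih n <;>
      obtain ⟨hb1, hb2⟩ := hb n <;> simp only [] at hv
    · simp only [xsum_cons_false, dsum_cons_false, dcount_cons_false]
      constructor <;> intro hn
      · have := ih1 hn; have := hb1 hn; omega
      · have := ih2 hn; have := hb2 hn; omega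
    · simp only [xsum_cons_true, dsum_cons_true, dcount_cons_true]
      constructor <;> intro hn
      · obtain _ | n := n
        · omega
        have := (ih n).2 (by omega)
        have := (hb n).2 (by omega)
        rw [show (n + 1) * N = n * N + N from Nat.succ_mul n N]
        omega
      · have := ih1 (by omega); have := hb1 (by omega); omega

/-- Moving one end of a pair of points along an unflagged walk preserves the parity, unless the two
distances are small. -/
theorem IsDistWalk.parity_or_K₂ {K₂ : ℕ} (hs : ∀ u v, d u v = d v u)
    (ht : ∀ u v w, d u w ≤ d u v + d v w)
    (hodd : ∀ u v w, (d u v + d v w + d u w) % 2 = 1 → d u v + d u w < 2 * K₂ + d v w)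
    {l : List (ℕ × Bool)} {u w : V} (h : IsDistWalk d l u w) (hl : dcount l = 0) (p : V) :
    d p u ≤ d p w + xsum l ∧ d p w ≤ d p u + xsum l ∧
    ((d p u + xsum l + d p w) % 2 = 0 ∨ d p u + d p w < 2 * K₂ + xsum l) := by
  induction l generalizing u with
  | nil => cases h; simp; omega
  | cons e l ih =>
    obtain ⟨v, hv, h⟩ := h
    have h1 := hodd p u v
    have h2 := ht p u v
    have h3 := ht p v u
    have h4 := hs v u
    obtain ⟨a, _ | _⟩ := e <;> simp at hl hv
    have := ih h hl
    simp
    omega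

/-- A closed walk with a flagged edge can be rotated so that it starts with a flagged edge. -/
theorem IsWalk.exists_rotate {R : V → V → ℕ → Prop} {l : List (ℕ × Bool)} {u : V}
    (h : IsWalk R l u u) (hl : 0 < dcount l) :
    ∃ v a m, IsWalk R ((a, true) :: m) v v ∧ 1 + dcount m = dcount l ∧ a + dsum m = dsum l ∧
      xsum m = xsum l := by
  obtain ⟨A, a, B, rfl, hA⟩ := exists_flagged_of_dcount_pos l hl
  obtain ⟨v, h1, h2⟩ := h.exists_of_append
  refine ⟨v, a, B ++ A, h2.append h1, ?_, ?_, ?_⟩ <;> simp <;> omega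

/-- Cut a walk that starts with a flagged edge just before the second flagged edge. -/
theorem IsWalk.exists_cut {R : V → V → ℕ → Prop} {l : List (ℕ × Bool)} {u w : V} {a : ℕ}
    (h : IsWalk R ((a, true) :: l) u w) (hl : 0 < dcount l) :
    ∃ v B b m, IsWalk R ((a, true) :: B) u v ∧ IsWalk R ((b, true) :: m) v w ∧ dcount B = 0 ∧
      1 + dcount m = dcount l ∧ b + dsum m = dsum l ∧ xsum B + xsum m = xsum l := by
  obtain ⟨A, b, B, rfl, hA⟩ := exists_flagged_of_dcount_pos l hl
  obtain ⟨v, h1, h2⟩ := IsWalk.exists_of_append (l := (a, true) :: A) h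
  have := dsum_eq_zero_of_dcount _ hA
  refine ⟨v, A, b, B, h1, h2, hA, ?_, ?_, ?_⟩ <;> simp <;> omega

/-- A closed walk is cut into such segments, each a flagged edge followed by unflagged ones. The
chord replacing a segment is nearly as long as the flagged edge, and it has the parity of the
segment unless the `K₂` bound makes both of them small. -/
theorem IsDistWalk.segment {K₂ : ℕ} (hs : ∀ u v, d u v = d v u)
    (ht : ∀ u v w, d u w ≤ d u v + d v w)
    (hodd : ∀ u v w, (d u v + d v w + d u w) % 2 = 1 → d u v + d u w < 2 * K₂ + d v w)
    {B : List (ℕ × Bool)} {a : ℕ} {u w : V} (h : IsDistWalk d ((a, true) :: B) u w)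
    (hB : dcount B = 0) :
    a ≤ d u w + xsum B ∧ ((a + xsum B + d u w) % 2 = 0 ∨ a + d u w < 2 * K₂ + xsum B) := by
  obtain ⟨v, hv, h⟩ := h
  simp only at hv
  have := IsDistWalk.parity_or_K₂ hs ht hodd h hB u
  omega

theorem IsDistWalk.head_le {δ : ℕ} (hδ : ∀ u v, d u v ≤ δ) {e : ℕ × Bool}
    {B : List (ℕ × Bool)} {u w : V} (h : IsDistWalk d (e :: B) u w) : e.1 ≤ δ := by
  obtain ⟨v, hv, -⟩ := h
  exact hv ▸ hδ u v

theorem IsDistWalk.K₂_two {K₂ : ℕ} (hs : ∀ u v, d u v = d v u)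
    (ht : ∀ u v w, d u w ≤ d u v + d v w)
    (hodd : ∀ u v w, (d u v + d v w + d u w) % 2 = 1 → d u v + d u w < 2 * K₂ + d v w)
    {l : List (ℕ × Bool)} {u : V} (h : IsDistWalk d l u u) (hl : dcount l = 2)
    (ho : (xsum l + dsum l) % 2 = 1) : dsum l ≤ 2 * K₂ + xsum l := by
  obtain ⟨p, a, m, hw, e1, e2, e3⟩ := IsWalk.exists_rotate h (by omega)
  obtain ⟨q, A, b, B, hA, hB, f0, f1, f2, f3⟩ := IsWalk.exists_cut hw (by omega)
  have hB0 : dcount B = 0 := by omega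
  have := dsum_eq_zero_of_dcount _ hB0
  obtain ⟨hA1, hA2⟩ := IsDistWalk.segment hs ht hodd hA f0
  obtain ⟨hB1, hB2⟩ := IsDistWalk.segment hs ht hodd hB hB0
  rw [hs q p] at hB1 hB2
  -- The two segments share the chord `d p q` and the total is odd, so they cannot both have its
  -- parity. One of them gives the `K₂` alternative, the other the plain lower bound on the chord.
  rcases hA2 with hA2 | hA2
  · rcases hB2 with hB2 | hB2 <;> omega
  · clear hB2
    omega

theorem IsDistWalk.segment_even {K₂ : ℕ} (hs : ∀ u v, d u v = d v u)
    (ht : ∀ u v w, d u w ≤ d u v + d v w)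
    (hodd : ∀ u v w, (d u v + d v w + d u w) % 2 = 1 → d u v + d u w < 2 * K₂ + d v w)
    {B : List (ℕ × Bool)} {a : ℕ} {u w : V} (h : IsDistWalk d ((a, true) :: B) u w)
    (hB : dcount B = 0) (ha : K₂ + xsum B ≤ a) :
    a ≤ d u w + xsum B ∧ (a + xsum B + d u w) % 2 = 0 := by
  obtain ⟨h1, h2⟩ := IsDistWalk.segment hs ht hodd h hB
  exact ⟨h1, h2.resolve_right (by omega)⟩

theorem IsDistWalk.C_three {δ K₂ C : ℕ} (hs : ∀ u v, d u v = d v u)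
    (ht : ∀ u v w, d u w ≤ d u v + d v w)
    (hodd : ∀ u v w, (d u v + d v w + d u w) % 2 = 1 → d u v + d u w < 2 * K₂ + d v w)
    (hδ : ∀ u v, d u v ≤ δ) (hC : 2 * δ + K₂ ≤ C) (r : ℕ)
    (hp : ∀ u v w, (d u v + d v w + d u w) % 2 = r → d u v + d v w + d u w < C)
    {l : List (ℕ × Bool)} {u : V} (h : IsDistWalk d l u u) (hl : dcount l = 3)
    (ho : (xsum l + dsum l) % 2 = r) : dsum l < C + xsum l := by
  obtain ⟨p, a, m, hw, e1, e2, e3⟩ := IsWalk.exists_rotate h (by omega)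
  obtain ⟨q, A, b, m', hA, hw, f0, f1, f2, f3⟩ := IsWalk.exists_cut hw (by omega)
  obtain ⟨s, B, c, D, hB, hD, g0, g1, g2, g3⟩ := IsWalk.exists_cut hw (by omega)
  have hD0 : dcount D = 0 := by omega
  have hD1 := dsum_eq_zero_of_dcount _ hD0
  have ha : a ≤ δ := IsDistWalk.head_le hδ hA
  have hb : b ≤ δ := IsDistWalk.head_le hδ hB
  have hc : c ≤ δ := IsDistWalk.head_le hδ hD
  have hd : dsum l = a + b + c := by linarith
  have hx : xsum l = xsum A + xsum B + xsum D := by linarith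
  rw [hd, hx] at ho
  rw [hd, hx]
  by_contra! hcon
  -- As the other two flagged labels are at most `δ` and `2 * δ + K₂ ≤ C`, each flagged label
  -- exceeds `xsum l` by at least `K₂`. Hence all three chords keep the parities, and they form a
  -- triangle of parity `r` and perimeter at least `C`.
  obtain ⟨hA1, hA2⟩ := IsDistWalk.segment_even hs ht hodd hA f0 (by linarith)
  obtain ⟨hB1, hB2⟩ := IsDistWalk.segment_even hs ht hodd hB g0 (by linarith)
  obtain ⟨hD1, hD2⟩ := IsDistWalk.segment_even hs ht hodd hD hD0 (by linarith)
  rw [hs s p] at hD1 hD2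
  have := hp p q s (by
    clear * - hA2 hB2 hD2 ho
    omega)
  linarith

theorem IsDistWalk.K₂_four {δ K : ℕ} (hs : ∀ u v, d u v = d v u)
    (ht : ∀ u v w, d u w ≤ d u v + d v w)
    (hodd : ∀ u v w, (d u v + d v w + d u w) % 2 = 1 → d u v + d u w < 2 * K + d v w)
    (hδ : ∀ u v, d u v ≤ δ) (hK : 2 * δ = 3 * K + 1)
    (hp : ∀ u v w, (d u v + d v w + d u w) % 2 = 1 → d u v + d v w + d u w ≤ 4 * K)
    {l : List (ℕ × Bool)} {u : V} (h : IsDistWalk d l u u) (hl : dcount l = 4)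
    (ho : (xsum l + dsum l) % 2 = 1) : dsum l ≤ 2 * K + 4 * K + xsum l := by
  obtain ⟨p, a, m, hw, e1, e2, e3⟩ := IsWalk.exists_rotate h (by omega)
  obtain ⟨q, A, b, m', hA, hw, f0, f1, f2, f3⟩ := IsWalk.exists_cut hw (by omega)
  obtain ⟨s, B, c, m'', hB, hw, g0, g1, g2, g3⟩ := IsWalk.exists_cut hw (by omega)
  obtain ⟨t, D, e, E, hD, hE, i0, i1, i2, i3⟩ := IsWalk.exists_cut hw (by omega)
  have hE0 : dcount E = 0 := by omega
  have hE1 := dsum_eq_zero_of_dcount _ hE0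
  have ha : a ≤ δ := IsDistWalk.head_le hδ hA
  have hb : b ≤ δ := IsDistWalk.head_le hδ hB
  have hc : c ≤ δ := IsDistWalk.head_le hδ hD
  have he : e ≤ δ := IsDistWalk.head_le hδ hE
  have hd : dsum l = a + b + c + e := by linarith
  have hx : xsum l = xsum A + xsum B + xsum D + xsum E := by linarith
  rw [hd, hx] at ho
  rw [hd, hx]
  by_contra! hcon
  clear h hw hl e1 e2 e3 f1 f2 f3 g1 g2 g3 i1 i2 i3 hd hx
  obtain ⟨hA1, hA2⟩ := IsDistWalk.segment_even hs ht hodd hA f0 (by linarith)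
  obtain ⟨hB1, hB2⟩ := IsDistWalk.segment_even hs ht hodd hB g0 (by linarith)
  obtain ⟨hD1, hD2⟩ := IsDistWalk.segment_even hs ht hodd hD i0 (by linarith)
  obtain ⟨hE1, hE2⟩ := IsDistWalk.segment_even hs ht hodd hE hE0 (by linarith)
  have k1 := hδ p q
  have k2 := hδ q s
  have k3 := hδ s t
  have k4 := hδ t p
  have k5 := hs s p
  have hpar : (d p q + d q s + d s t + d t p) % 2 = 1 := by
    clear * - hA2 hB2 hD2 hE2 ho
    omega
  have hsum : 6 * K + 1 ≤ d p q + d q s + d s t + d t p := by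
    linarith
  -- In such an odd triangle the perimeter bound gives `d x z ≤ K`, while the `K₂` bound gives `d x
  -- z > K`. The quadrilateral of chords has odd perimeter at least `6 * K + 1`, and any two of its
  -- sides sum to at least `6 * K + 1 - 2 * δ = 3 * K`; one of the halves cut off by the diagonal `p
  -- s` is odd.
  have key : ∀ x y z, 3 * K ≤ d x y + d y z → (d x y + d y z + d x z) % 2 = 1 → False := by
    intro x y z hxy ho
    have h1 := hp x y z ho
    have h2 := hodd y x z (by rw [hs y x, add_right_comm]; exact ho)
    rw [hs y x] at h2
    clear * - h1 h2 hxy ho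
    omega
  rcases Nat.mod_two_eq_zero_or_one (d p q + d q s + d p s) with hpar' | hpar'
  · refine key s t p (by linarith) ?_
    clear * - hpar hpar' k5
    omega
  · exact key p q s (by linarith) hpar'

end DistWalk

/-! ### Completion as a median of bounds -/

/-- `d u v` is the median of `M`, the largest lower bound `Lo u v` and the smallest upper bound
`Up u v`. -/
structure IsClamp {V : Type*} (M : ℕ) (Up Lo : V → V → ℕ → Prop) (d : V → V → ℕ) : Prop where
  le_up : ∀ {u v a}, Up u v a → d u v ≤ a
  lo_le : ∀ {u v b}, Lo u v b → b ≤ d u v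
  up : ∀ {u v}, d u v < M → Up u v (d u v)
  lo : ∀ {u v}, M < d u v → Lo u v (d u v)

/-- Upper and lower bounds on the distances, closed under the triangle inequality. -/
structure BoundSystem {V : Type*} (δ : ℕ) (R Up Lo : V → V → ℕ → Prop) : Prop where
  up_symm : ∀ {u v a}, Up u v a → Up v u a
  lo_symm : ∀ {u v b}, Lo u v b → Lo v u b
  up_trans : ∀ {u v w a b}, Up u v a → Up v w b → Up u w (a + b)
  lo_trans : ∀ {u v w a b}, Lo u v (b + a) → Up v w a → Lo u w b
  up_self : ∀ u, Up u u 0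
  eq_of_up : ∀ {u v}, Up u v 0 → u = v
  lo_le : ∀ {u v b}, Lo u v b → b ≤ δ
  up_edge : ∀ {u v ℓ}, R u v ℓ → Up u v ℓ
  lo_edge : ∀ {u v ℓ}, R u v ℓ → Lo u v ℓ

section Clamp

variable {V : Type*} {δ M : ℕ} {R Up Lo : V → V → ℕ → Prop} {d : V → V → ℕ}

theorem BoundSystem.exists_isClamp (hB : BoundSystem δ R Up Lo) (M : ℕ)
    (h : ∀ {u v a b}, Up u v a → Lo u v b → b ≤ a) : ∃ d, IsClamp M Up Lo d := by
  classical
  have key : ∀ u v, ∃ t, (∀ a, Up u v a → t ≤ a) ∧ (∀ b, Lo u v b → b ≤ t) ∧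
      (t < M → Up u v t) ∧ (M < t → Lo u v t) := by
    intro u v
    by_cases h1 : ∃ b, M < b ∧ Lo u v b
    · obtain ⟨b, hMb, hb⟩ := h1
      have hs := Nat.findGreatest_spec (P := Lo u v) (hB.lo_le hb) hb
      have hm : ∀ c, Lo u v c → c ≤ Nat.findGreatest (Lo u v) δ := fun c hc =>
        Nat.le_findGreatest (hB.lo_le hc) hc
      exact ⟨_, fun a ha => h ha hs, hm, fun h' => absurd (hm b hb) (by omega), fun _ => hs⟩
    by_cases h2 : ∃ a, a < M ∧ Up u v a
    · obtain ⟨a, haM, ha⟩ := h2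
      have hs := Nat.find_spec ⟨a, ha⟩
      have hm : ∀ c, Up u v c → Nat.find ⟨a, ha⟩ ≤ c := fun c hc => Nat.find_min' _ hc
      exact ⟨_, hm, fun b hb => h hs hb, fun _ => hs, fun h' => absurd (hm a ha) (by omega)⟩
    push Not at h1 h2
    exact ⟨M, fun a ha => not_lt.1 fun h' => h2 a h' ha, fun b hb => not_lt.1 fun h' => h1 b h' hb,
      fun h' => absurd h' (lt_irrefl _), fun h' => absurd h' (lt_irrefl _)⟩
  choose d hd using key
  exact ⟨d, fun {u v a} => (hd u v).1 a, fun {u v b} => (hd u v).2.1 b,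
    fun {u v} => (hd u v).2.2.1, fun {u v} => (hd u v).2.2.2⟩

namespace IsClamp

theorem symm (hd : IsClamp M Up Lo d) (hB : BoundSystem δ R Up Lo) (u v : V) :
    d u v = d v u := by
  have key : ∀ u v, d v u ≤ d u v := by
    intro u v
    by_contra! h
    rcases lt_or_ge (d u v) M with h1 | h1
    · have := hd.le_up (hB.up_symm (hd.up h1))
      omega
    · have := hd.lo_le (hB.lo_symm (hd.lo (h1.trans_lt h)))
      omega
  exact le_antisymm (key v u) (key u v)

theorem eq_zero_iff (hd : IsClamp M Up Lo d) (hB : BoundSystem δ R Up Lo) (hM : 0 < M) (u v : V) :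
    d u v = 0 ↔ u = v := by
  constructor
  · intro h
    have := hd.up (u := u) (v := v) (by omega)
    rw [h] at this
    exact hB.eq_of_up this
  · rintro rfl
    exact Nat.le_zero.1 (hd.le_up (hB.up_self u))

theorem le_diam (hd : IsClamp M Up Lo d) (hB : BoundSystem δ R Up Lo) (hM : M ≤ δ) (u v : V) :
    d u v ≤ δ := by
  rcases lt_or_ge M (d u v) with h | h
  · exact hB.lo_le (hd.lo h)
  · omega

theorem eq_of_edge (hd : IsClamp M Up Lo d) (hB : BoundSystem δ R Up Lo) {u v : V} {ℓ : ℕ}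
    (h : R u v ℓ) : d u v = ℓ :=
  le_antisymm (hd.le_up (hB.up_edge h)) (hd.lo_le (hB.lo_edge h))

/-- Since `δ ≤ 2 * M`, two sides of length at least `M` cannot be too short for the third. Otherwise
a side below `M` is an upper bound, and it is combined with the bound of another side that is not
the default `M`. -/
theorem triangle (hd : IsClamp M Up Lo d) (hB : BoundSystem δ R Up Lo) (hM : M ≤ δ)
    (hM' : δ ≤ 2 * M) (u v w : V) : d u w ≤ d u v + d v w := by
  have key : ∀ u v w, d v w < M → M < d u w → d u w ≤ d u v + d v w := by
    intro u v w h1 h2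
    by_contra! h
    have h3 := hd.lo h2
    have h4 : Lo u v (d u w - d v w) := by
      refine hB.lo_trans (a := d v w) ?_ (hB.up_symm (hd.up h1))
      rwa [Nat.sub_add_cancel (by omega)]
    have := hd.lo_le h4
    omega
  have hδ := hd.le_diam hB hM u w
  rcases lt_or_ge (d v w) M with h1 | h1
  · rcases lt_or_ge M (d u w) with h2 | h2
    · exact key u v w h1 h2
    rcases lt_or_ge (d u v) M with h3 | h3
    · exact hd.le_up (hB.up_trans (hd.up h3) (hd.up h1))
    · omega
  · rcases lt_or_ge (d u v) M with h3 | h3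
    · rcases lt_or_ge M (d u w) with h2 | h2
      · have := key w v u (by rwa [hd.symm hB]) (by rwa [hd.symm hB])
        rw [hd.symm hB w u, hd.symm hB w v, hd.symm hB v u] at this
        omega
      · omega
    · omega

end IsClamp

end Clamp

/-! ### Bounds carried by walks -/

section WalkBounds

variable {V : Type*} (R : V → V → ℕ → Prop) {δ N : ℕ}

/-- `a` is an upper bound on `d u v` implied by a walk, the triangle inequality and the bound `N`
on the perimeters of triangles. -/
def UpWalk (N : ℕ) (u v : V) (a : ℕ) : Prop :=
  ∃ l n, IsWalk R l u v ∧ dcount l = 2 * n ∧ a + dsum l = n * N + xsum l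

/-- `b` is a lower bound on `d u v` implied by a walk, the triangle inequality and the bound `N`
on the perimeters of triangles. -/
def LoWalk (N : ℕ) (u v : V) (b : ℕ) : Prop :=
  ∃ l n, IsWalk R l u v ∧ dcount l = 2 * n + 1 ∧ b + n * N + xsum l = dsum l

/-- `a` is the length of a walk from `u` to `v`. -/
def UpMetric (u v : V) (a : ℕ) : Prop :=
  ∃ l, IsWalk R l u v ∧ dcount l = 0 ∧ a = xsum l

/-- `b` is a lower bound on `d u v` implied by a walk and the triangle inequality. -/
def LoMetric (u v : V) (b : ℕ) : Prop :=
  ∃ l, IsWalk R l u v ∧ dcount l = 1 ∧ b + xsum l = dsum l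

variable {R}

theorem IsWalk.eq_nil_of_xsum_eq_zero {l : List (ℕ × Bool)} {u v : V} (h : IsWalk R l u v)
    (hpos : ∀ u v ℓ, R u v ℓ → 1 ≤ ℓ) (hx : xsum l = 0) (hl : dcount l = 0) : u = v := by
  obtain _ | ⟨⟨a, _ | _⟩, l⟩ := l
  · exact h
  · obtain ⟨x, hx', -⟩ := h
    have := hpos _ _ _ hx'
    simp at hx this
    omega
  · simp at hl

theorem boundSystem_walk (hsymm : ∀ u v ℓ, R u v ℓ → R v u ℓ) (hpos : ∀ u v ℓ, R u v ℓ → 1 ≤ ℓ)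
    (hle : ∀ u v ℓ, R u v ℓ → ℓ ≤ δ) (hN : 2 * δ < N) :
    BoundSystem δ R (UpWalk R N) (LoWalk R N) where
  up_symm := by
    rintro u v a ⟨l, n, h, h1, h2⟩
    exact ⟨l.reverse, n, h.reverse hsymm, by simpa, by simpa⟩
  lo_symm := by
    rintro u v a ⟨l, n, h, h1, h2⟩
    exact ⟨l.reverse, n, h.reverse hsymm, by simpa, by simpa⟩
  up_trans := by
    rintro u v w a b ⟨l, n, h, h1, h2⟩ ⟨l', n', h', h1', h2'⟩
    refine ⟨l ++ l', n + n', h.append h', by simp; omega, ?_⟩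
    simp only [dsum_append, xsum_append, add_mul]
    omega
  lo_trans := by
    rintro u v w a b ⟨l, n, h, h1, h2⟩ ⟨l', n', h', h1', h2'⟩
    refine ⟨l ++ l', n + n', h.append h', by simp; omega, ?_⟩
    simp only [dsum_append, xsum_append, add_mul]
    omega
  up_self := fun u => ⟨[], 0, rfl, rfl, by simp⟩
  eq_of_up := by
    rintro u v ⟨l, n, h, h1, h2⟩
    have h3 := h.dsum_le hle
    rw [h1] at h3
    obtain _ | n := n
    · refine h.eq_nil_of_xsum_eq_zero hpos ?_ h1
      have := dsum_eq_zero_of_dcount _ h1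
      omega
    -- Each pair of flagged edges contributes at least `N - 2 * δ > 0`, so an upper bound `0` uses
    -- no flags.
    · nlinarith
  lo_le := by
    rintro u v b ⟨l, n, h, h1, h2⟩
    have h3 := h.dsum_le hle
    rw [h1] at h3
    nlinarith [Nat.zero_le n]
  up_edge := fun {u v ℓ} h => ⟨[(ℓ, false)], 0, ⟨v, h, rfl⟩, rfl, by simp⟩
  lo_edge := fun {u v ℓ} h => ⟨[(ℓ, true)], 0, ⟨v, h, rfl⟩, rfl, by simp⟩

theorem boundSystem_metric (hsymm : ∀ u v ℓ, R u v ℓ → R v u ℓ)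
    (hpos : ∀ u v ℓ, R u v ℓ → 1 ≤ ℓ) (hle : ∀ u v ℓ, R u v ℓ → ℓ ≤ δ) :
    BoundSystem δ R (UpMetric R) (LoMetric R) where
  up_symm := by
    rintro u v a ⟨l, h, h1, h2⟩
    exact ⟨l.reverse, h.reverse hsymm, by simpa, by simpa⟩
  lo_symm := by
    rintro u v a ⟨l, h, h1, h2⟩
    exact ⟨l.reverse, h.reverse hsymm, by simpa, by simpa⟩
  up_trans := by
    rintro u v w a b ⟨l, h, h1, h2⟩ ⟨l', h', h1', h2'⟩
    exact ⟨l ++ l', h.append h', by simp; omega, by simp; omega⟩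
  lo_trans := by
    rintro u v w a b ⟨l, h, h1, h2⟩ ⟨l', h', h1', h2'⟩
    have := dsum_eq_zero_of_dcount _ h1'
    exact ⟨l ++ l', h.append h', by simp; omega, by simp; omega⟩
  up_self := fun u => ⟨[], rfl, rfl, by simp⟩
  eq_of_up := by
    rintro u v ⟨l, h, h1, h2⟩
    exact h.eq_nil_of_xsum_eq_zero hpos h2.symm h1
  lo_le := by
    rintro u v b ⟨l, h, h1, h2⟩
    have h3 := h.dsum_le hle
    rw [h1] at h3
    omega
  up_edge := fun {u v ℓ} h => ⟨[(ℓ, false)], ⟨v, h, rfl⟩, rfl, by simp⟩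
  lo_edge := fun {u v ℓ} h => ⟨[(ℓ, true)], ⟨v, h, rfl⟩, rfl, by simp⟩

end WalkBounds

/-! ### Completion when `C₀` and `C₁` are consecutive -/

section Completion

variable {V : Type*} {R : V → V → ℕ → Prop} {δ N : ℕ}

/-- A pair of flagged edges already contributes `N - 2 * δ ≥ K`, so upper bounds below `K` are
lengths of plain walks. -/
theorem UpWalk.le_of_pos {K : ℕ} (hle : ∀ u v ℓ, R u v ℓ → ℓ ≤ δ) (hK : 2 * δ + K ≤ N)
    {u v : V} {a : ℕ} (h : UpWalk R N u v a) :
    K ≤ a ∨ ∃ l, IsWalk R l u v ∧ dcount l = 0 ∧ a = xsum l := by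
  obtain ⟨l, n, h, h1, h2⟩ := h
  have h3 := h.dsum_le hle
  obtain _ | n := n
  · right
    have := dsum_eq_zero_of_dcount _ h1
    exact ⟨l, h, h1, by omega⟩
  · left
    rw [h1] at h3
    nlinarith

/-- Triangle conditions are stated for all triples of points, degenerate ones included. -/
theorem InClassA.of_triangles {K₁ K₂ C₀ C₁ : ℕ} {d : V → V → ℕ}
    (eq_zero_iff : ∀ u v, d u v = 0 ↔ u = v) (symm : ∀ u v, d u v = d v u)
    (triangle : ∀ u v w, d u w ≤ d u v + d v w) (le_diam : ∀ u v, d u v ≤ δ)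
    (hK₁ : ∀ u v w, (d u v + d v w + d u w) % 2 = 1 → 2 * K₁ ≤ d u v + d v w + d u w)
    (hK₂ : ∀ u v w, (d u v + d v w + d u w) % 2 = 1 → d u v + d v w ≤ 2 * K₂ + d u w)
    (hC₁ : ∀ u v w, u ≠ v → v ≠ w → u ≠ w → (d u v + d v w + d u w) % 2 = 1 →
      d u v + d v w + d u w < C₁)
    (hC₀ : ∀ u v w, u ≠ v → v ≠ w → u ≠ w → (d u v + d v w + d u w) % 2 = 0 →
      d u v + d v w + d u w < C₀) :
    InClassA δ K₁ K₂ C₀ C₁ d where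
  eq_zero_iff := eq_zero_iff
  symm := symm
  triangle := triangle
  le_diam := le_diam
  odd_K := by
    intro u v w _ _ _ ho
    rw [Nat.odd_iff] at ho
    have e1 := symm v u
    have e2 := symm w v
    -- Non-strict bounds suffice: each compares the odd perimeter with an even number.
    have h1 := hK₁ u v w (by omega)
    have h2 := hK₂ u v w (by omega)
    have h3 := hK₂ u w v (by omega)
    have h4 := hK₂ v u w (by omega)
    omega
  odd_C₁ := by
    intro u v w h1 h2 h3 ho
    rw [Nat.odd_iff] at ho
    have := hC₁ u v w h1 h2 h3 (by omega)
    omega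
  even_C₀ := by
    intro u v w h1 h2 h3 ho
    rw [Nat.even_iff] at ho
    have := hC₀ u v w h1 h2 h3 (by omega)
    omega

-- Here `N` is `C - 1`. The first alternative of `hcase` is Case II, where `N` is even and the `K₂`
-- condition also yields the `K₁` bound for walks with flags. The second is Case III, where `N` is
-- so large that flags play no role in the `K₁` and `K₂` constraints.
set_option maxHeartbeats 1000000 in
theorem exists_inClassA_of_adjacent {M K₁ K₂ C₀ C₁ : ℕ}
    (hsymm : ∀ u v ℓ, R u v ℓ → R v u ℓ) (hpos : ∀ u v ℓ, R u v ℓ → 1 ≤ ℓ)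
    (hle : ∀ u v ℓ, R u v ℓ → ℓ ≤ δ) (hN : 2 * δ < N)
    (hM0 : 0 < M) (hMδ : M ≤ δ) (hδM : δ ≤ 2 * M) (hMN : 2 * M + δ ≤ N)
    (hM₁ : K₁ ≤ M) (hM₂ : M ≤ K₂) (hC₀ : N < C₀) (hC₁ : N < C₁)
    (hcase : N = 2 * K₁ + 2 * K₂ ∨
      2 * δ + K₁ ≤ N ∧ 2 * δ ≤ 2 * K₂ + M ∧ 4 * δ ≤ 2 * K₂ + N)
    (wC : ∀ u l n, IsWalk R l u u → dcount l = 2 * n + 1 → dsum l ≤ n * N + xsum l)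
    (wK₁ : ∀ u l, IsWalk R l u u → dcount l = 0 → xsum l % 2 = 1 → 2 * K₁ ≤ xsum l)
    (wK₂ : ∀ u l n, IsWalk R l u u → dcount l = 2 * n + 2 → (xsum l + dsum l) % 2 = 1 →
      dsum l ≤ 2 * K₂ + n * N + xsum l) :
    ∃ d, InClassA δ K₁ K₂ C₀ C₁ d ∧ ∀ u v ℓ, R u v ℓ → d u v = ℓ := by
  have hB := boundSystem_walk (δ := δ) (N := N) hsymm hpos hle hN
  obtain ⟨d, hd⟩ := hB.exists_isClamp M (by
    rintro u v a b ⟨l, n, h, h1, h2⟩ ⟨l', n', h', h1', h2'⟩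
    have := wC u (l ++ l'.reverse) (n + n') (h.append (h'.reverse hsymm)) (by simp; omega)
    simp only [dsum_append, xsum_append, dsum_reverse, xsum_reverse, add_mul] at this
    omega)
  have sym := hd.symm hB
  have tri := hd.triangle hB hMδ hδM
  have dia := hd.le_diam hB hMδ
  -- The lower-bound walks of two long sides concatenate to an upper-bound walk, of value `N - d u v
  -- - d v w`, for the third side.
  have perim' : ∀ u v w, M < d u v → M < d v w → d u v + d v w + d u w ≤ N := by
    intro u v w h1 h2
    obtain ⟨l, n, h, e1, e2⟩ := hd.lo h1
    obtain ⟨l', n', h', e1', e2'⟩ := hd.lo h2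
    have hw := h.append h'
    have hs := hw.dsum_le hle
    have hn : dcount (l ++ l') = 2 * (n + n' + 1) := by simp; omega
    have h3 : UpWalk R N u w (N - d u v - d v w) := by
      have := dia u v
      have := dia v w
      refine ⟨_, _, hw, hn, ?_⟩
      simp only [dsum_append, xsum_append, add_mul, one_mul]
      omega
    have := hd.le_up h3
    have := dia u v
    have := dia v w
    omega
  have perim : ∀ u v w, d u v + d v w + d u w ≤ N := by
    intro u v w
    have h1 := dia u v
    have h2 := dia v w
    have h3 := dia u w
    have e1 := sym v u
    have e2 := sym w v
    have p1 := perim' u v w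
    have p2 := perim' u w v
    have p3 := perim' v u w
    rw [e1] at p3
    rw [e2] at p2
    -- By `2 * M + δ ≤ N`, a perimeter above `N` needs two sides longer than `M`.
    by_contra! hcon
    rcases lt_or_ge M (d u v) with k1 | k1
    · rcases lt_or_ge M (d v w) with k2 | k2
      · have := p1 k1 k2
        omega
      · have := p3 k1 (by omega)
        omega
    · have := p2 (by omega) (by omega)
      omega
  have key₁ : ∀ u v w, (d u v + d v w + d u w) % 2 = 1 → 2 * K₁ ≤ d u v + d v w + d u w := by
    intro u v w ho
    by_contra! hcon
    have t1 := tri u v w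
    have t2 := tri v u w
    have t3 := tri u w v
    rw [sym v u] at t2
    rw [sym w v] at t3
    have k1 : d u v < K₁ := by omega
    have k2 : d v w < K₁ := by omega
    have k3 : d u w < K₁ := by omega
    have b1 := hd.up (k1.trans_le hM₁)
    have b2 := hd.up (k2.trans_le hM₁)
    have b3 := hd.up (k3.trans_le hM₁)
    rcases hcase with hcase | ⟨hcase, -⟩
    · obtain ⟨l, n, h, e1, e2⟩ := b1
      obtain ⟨l', n', h', e1', e2'⟩ := b2
      obtain ⟨l'', n'', h'', e1'', e2''⟩ := b3
      have hw := (h.append h').append (h''.reverse hsymm)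
      have hn : dcount (l ++ l' ++ l''.reverse) = 2 * (n + n' + n'') := by simp; omega
      have hsum : d u v + d v w + d u w + dsum (l ++ l' ++ l''.reverse) =
          (n + n' + n'') * N + xsum (l ++ l' ++ l''.reverse) := by
        simp only [dsum_append, xsum_append, add_mul, dsum_reverse, xsum_reverse]
        omega
      generalize n + n' + n'' = m at hn hsum
      generalize l ++ l' ++ l''.reverse = L at *
      have hN2 : m * N = 2 * (m * (K₁ + K₂)) := by rw [hcase]; ring
      obtain _ | m := m
      · have := dsum_eq_zero_of_dcount _ hn
        have := wK₁ u L hw hn (by omega)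
        omega
      -- One pair of flags is set apart: the `K₂` condition bounds the perimeter of the triangle
      -- below by `N - 2 * K₂ = 2 * K₁`.
      · have h5 := wK₂ u L m hw (by omega) (by omega)
        have h6 : (m + 1) * N = m * N + N := by ring
        omega
    · obtain ⟨l, h, e1, e2⟩ := (b1.le_of_pos hle hcase).resolve_left (by omega)
      obtain ⟨l', h', e1', e2'⟩ := (b2.le_of_pos hle hcase).resolve_left (by omega)
      obtain ⟨l'', h'', e1'', e2''⟩ := (b3.le_of_pos hle hcase).resolve_left (by omega)
      have := wK₁ u _ ((h.append h').append (h''.reverse hsymm)) (by simp; omega)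
        (by simp; omega)
      simp at this
      omega
  have key₂ : ∀ u v w, (d u v + d v w + d u w) % 2 = 1 → d u v + d v w ≤ 2 * K₂ + d u w := by
    intro u v w ho
    by_contra! hcon
    have t2 := tri v u w
    have t3 := tri u w v
    have p := perim u v w
    rw [sym v u] at t2
    rw [sym w v] at t3
    have k1 : M < d u v := by omega
    have k2 : M < d v w := by omega
    have hu := dia u v
    have hv := dia v w
    have k3 : d u w < M := by omega
    obtain ⟨l, n, h, e1, e2⟩ := hd.lo k1
    obtain ⟨l', n', h', e1', e2'⟩ := hd.lo k2
    obtain ⟨l'', n'', h'', e1'', e2''⟩ := hd.up k3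
    have hw := (h.append h').append (h''.reverse hsymm)
    have hn : dcount (l ++ l' ++ l''.reverse) = 2 * (n + n' + n'') + 2 := by simp; omega
    have hsum : d u v + d v w + (n + n' + n'') * N + xsum (l ++ l' ++ l''.reverse) =
          dsum (l ++ l' ++ l''.reverse) + d u w := by
      simp only [dsum_append, xsum_append, add_mul, dsum_reverse, xsum_reverse]
      omega
    have hdl := hw.dsum_le hle
    rw [hn] at hdl
    generalize n + n' + n'' = m at hn hsum hdl
    generalize l ++ l' ++ l''.reverse = L at *
    have h5 := wK₂ u L m hw hn
    rcases hcase with hcase | ⟨hcase, -, hcase'⟩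
    · have hN2 : m * N = 2 * (m * (K₁ + K₂)) := by rw [hcase]; ring
      have := h5 (by omega)
      omega
    · obtain _ | m := m
      · have := h5 (by omega)
        omega
      -- `N` may be odd, so the parity of the walk is unknown; but `4 * δ ≤ 2 * K₂ + N` already
      -- makes its flagged sum too small.
      · have h6 : m * (2 * δ) ≤ m * N := Nat.mul_le_mul_left _ hN.le
        have h7 : (m + 1) * N = m * N + N := by ring
        have h8 : (2 * (m + 1) + 2) * δ = m * (2 * δ) + 4 * δ := by ring
        omega
  refine ⟨d, InClassA.of_triangles (hd.eq_zero_iff hB hM0) sym tri dia key₁ key₂ ?_ ?_,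
    fun u v ℓ h => hd.eq_of_edge hB h⟩
  · intro u v w _ _ _ _
    have := perim u v w
    omega
  · intro u v w _ _ _ _
    have := perim u v w
    omega

end Completion

/-! ### Completion from metric bounds: Case III with a gap, and Case IIB -/

section MetricCompletion

variable {V : Type*} {R : V → V → ℕ → Prop} {δ M : ℕ} {d : V → V → ℕ}

theorem exists_isClamp_metric (hsymm : ∀ u v ℓ, R u v ℓ → R v u ℓ)
    (hB : BoundSystem δ R (UpMetric R) (LoMetric R)) (M : ℕ)
    (wNM : ∀ u l, IsWalk R l u u → dcount l = 1 → dsum l ≤ xsum l) :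
    ∃ d, IsClamp M (UpMetric R) (LoMetric R) d := by
  refine hB.exists_isClamp M ?_
  rintro u v a b ⟨l, h, h1, h2⟩ ⟨l', h', h1', h2'⟩
  have := wNM u (l ++ l'.reverse) (h.append (h'.reverse hsymm)) (by simp; omega)
  simp only [dsum_append, xsum_append, dsum_reverse, xsum_reverse] at this
  omega

namespace IsClamp

theorem metric_le_perimeter {K₁ : ℕ} (hd : IsClamp M (UpMetric R) (LoMetric R) d)
    (hsymm : ∀ u v ℓ, R u v ℓ → R v u ℓ)
    (wK₁ : ∀ u l, IsWalk R l u u → dcount l = 0 → xsum l % 2 = 1 → 2 * K₁ ≤ xsum l)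
    {u v w : V} (h₁ : d u v < M) (h₂ : d v w < M) (h₃ : d u w < M)
    (ho : (d u v + d v w + d u w) % 2 = 1) : 2 * K₁ ≤ d u v + d v w + d u w := by
  obtain ⟨l, h, e1, e2⟩ := hd.up h₁
  obtain ⟨l', h', e1', e2'⟩ := hd.up h₂
  obtain ⟨l'', h'', e1'', e2''⟩ := hd.up h₃
  have := wK₁ u _ ((h.append h').append (h''.reverse hsymm)) (by simp; omega) (by simp; omega)
  simp at this
  omega

theorem metric_add_le {K₂ : ℕ} (hd : IsClamp M (UpMetric R) (LoMetric R) d)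
    (hsymm : ∀ u v ℓ, R u v ℓ → R v u ℓ)
    (wK₂ : ∀ u l, IsWalk R l u u → dcount l = 2 → (xsum l + dsum l) % 2 = 1 →
      dsum l ≤ 2 * K₂ + xsum l)
    {u v w : V} (h₁ : M < d u v) (h₂ : M < d v w) (h₃ : d u w < M)
    (ho : (d u v + d v w + d u w) % 2 = 1) : d u v + d v w ≤ 2 * K₂ + d u w := by
  obtain ⟨l, h, e1, e2⟩ := hd.lo h₁
  obtain ⟨l', h', e1', e2'⟩ := hd.lo h₂
  obtain ⟨l'', h'', e1'', e2''⟩ := hd.up h₃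
  have := dsum_eq_zero_of_dcount _ e1''
  have := wK₂ u _ ((h.append h').append (h''.reverse hsymm)) (by simp; omega) (by simp; omega)
  simp at this
  omega

theorem metric_perimeter_lt {C r : ℕ} (hd : IsClamp M (UpMetric R) (LoMetric R) d)
    (hsymm : ∀ u v ℓ, R u v ℓ → R v u ℓ)
    (wC : ∀ u l, IsWalk R l u u → dcount l = 3 → (xsum l + dsum l) % 2 = r →
      dsum l < C + xsum l)
    {u v w : V} (h₁ : M < d u v) (h₂ : M < d v w) (h₃ : M < d u w)
    (ho : (d u v + d v w + d u w) % 2 = r) : d u v + d v w + d u w < C := by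
  obtain ⟨l, h, e1, e2⟩ := hd.lo h₁
  obtain ⟨l', h', e1', e2'⟩ := hd.lo h₂
  obtain ⟨l'', h'', e1'', e2''⟩ := hd.lo h₃
  have := wC u _ ((h.append h').append (h''.reverse hsymm)) (by simp; omega) (by simp; omega)
  simp at this
  omega

end IsClamp

/-- The bounds `2 * δ + M < C₀, C₁` force all sides of a triangle with too large a perimeter above
`M`, and `2 * δ ≤ 2 * K₂ + M` forces the short side of a `K₂` violation below `M`. -/
theorem exists_inClassA_of_large {K₁ K₂ C₀ C₁ : ℕ}
    (hsymm : ∀ u v ℓ, R u v ℓ → R v u ℓ) (hpos : ∀ u v ℓ, R u v ℓ → 1 ≤ ℓ)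
    (hle : ∀ u v ℓ, R u v ℓ → ℓ ≤ δ)
    (hM0 : 0 < M) (hMδ : M ≤ δ) (hδM : δ ≤ 2 * M)
    (hM₁ : K₁ ≤ M) (hM₂ : M ≤ K₂) (hM₃ : 2 * δ ≤ 2 * K₂ + M)
    (hC₀ : 2 * δ + M < C₀) (hC₁ : 2 * δ + M < C₁)
    (wNM : ∀ u l, IsWalk R l u u → dcount l = 1 → dsum l ≤ xsum l)
    (wC₀ : ∀ u l, IsWalk R l u u → dcount l = 3 → (xsum l + dsum l) % 2 = 0 →
      dsum l < C₀ + xsum l)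
    (wC₁ : ∀ u l, IsWalk R l u u → dcount l = 3 → (xsum l + dsum l) % 2 = 1 →
      dsum l < C₁ + xsum l)
    (wK₁ : ∀ u l, IsWalk R l u u → dcount l = 0 → xsum l % 2 = 1 → 2 * K₁ ≤ xsum l)
    (wK₂ : ∀ u l, IsWalk R l u u → dcount l = 2 → (xsum l + dsum l) % 2 = 1 →
      dsum l ≤ 2 * K₂ + xsum l) :
    ∃ d, InClassA δ K₁ K₂ C₀ C₁ d ∧ ∀ u v ℓ, R u v ℓ → d u v = ℓ := by
  have hB := boundSystem_metric hsymm hpos hle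
  obtain ⟨d, hd⟩ := exists_isClamp_metric hsymm hB M wNM
  have sym := hd.symm hB
  have tri := hd.triangle hB hMδ hδM
  have dia := hd.le_diam hB hMδ
  have perim : ∀ C r, 2 * δ + M < C → (∀ u l, IsWalk R l u u → dcount l = 3 →
      (xsum l + dsum l) % 2 = r → dsum l < C + xsum l) → ∀ u v w,
      (d u v + d v w + d u w) % 2 = r → d u v + d v w + d u w < C := by
    intro C r hC wC u v w ho
    have h1 := dia u v
    have h2 := dia v w
    have h3 := dia u w
    by_contra! hcon
    have := hd.metric_perimeter_lt hsymm wC (u := u) (v := v) (w := w) (by omega) (by omega)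
      (by omega) ho
    omega
  refine ⟨d, InClassA.of_triangles (hd.eq_zero_iff hB hM0) sym tri dia ?_ ?_
    (fun u v w _ _ _ => perim C₁ 1 hC₁ wC₁ u v w) (fun u v w _ _ _ => perim C₀ 0 hC₀ wC₀ u v w),
    fun u v ℓ h => hd.eq_of_edge hB h⟩
  · intro u v w ho
    by_contra! hcon
    have t1 := tri u v w
    have t2 := tri v u w
    have t3 := tri u w v
    rw [sym v u] at t2
    rw [sym w v] at t3
    have := hd.metric_le_perimeter hsymm wK₁ (u := u) (v := v) (w := w) (by omega) (by omega)
      (by omega) ho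
    omega
  · intro u v w ho
    by_contra! hcon
    have t2 := tri v u w
    have t3 := tri u w v
    have h1 := dia u v
    have h2 := dia v w
    rw [sym v u] at t2
    rw [sym w v] at t3
    have := hd.metric_add_le hsymm wK₂ (u := u) (v := v) (w := w) (by omega) (by omega)
      (by omega) ho
    omega

/-- The three sides of a triangle satisfy the constraints with `K₁ = K₂ = K`. -/
def TriangleOK (K C₀ C₁ a b c : ℕ) : Prop :=
  a ≤ b + c ∧ b ≤ a + c ∧ c ≤ a + b ∧
  ((a + b + c) % 2 = 1 → 2 * K ≤ a + b + c ∧ a + b ≤ 2 * K + c ∧ a + c ≤ 2 * K + b ∧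
    b + c ≤ 2 * K + a ∧ a + b + c < C₁) ∧
  ((a + b + c) % 2 = 0 → a + b + c < C₀)

theorem TriangleOK.rotate {K C₀ C₁ a b c : ℕ} (h : TriangleOK K C₀ C₁ a b c) :
    TriangleOK K C₀ C₁ b c a := by
  obtain ⟨h1, h2, h3, h4, h5⟩ := h
  refine ⟨by omega, by omega, by omega, fun ho => ?_, fun ho => ?_⟩
  · have := h4 (by omega)
    omega
  · have := h5 (by omega)
    omega

theorem TriangleOK.swap {K C₀ C₁ a b c : ℕ} (h : TriangleOK K C₀ C₁ a b c) :
    TriangleOK K C₀ C₁ b a c := by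
  obtain ⟨h1, h2, h3, h4, h5⟩ := h
  refine ⟨by omega, by omega, by omega, fun ho => ?_, fun ho => ?_⟩
  · have := h4 (by omega)
    omega
  · have := h5 (by omega)
    omega

set_option maxHeartbeats 2000000 in
theorem exists_inClassA_of_caseIIB {K C₀ C₁ : ℕ} (hδ : 2 * δ = 3 * K + 1) (hK : 3 ≤ K)
    (hC₁ : C₁ = 4 * K + 1) (hC₀ : 4 * K + 4 ≤ C₀)
    (hsymm : ∀ u v ℓ, R u v ℓ → R v u ℓ) (hpos : ∀ u v ℓ, R u v ℓ → 1 ≤ ℓ)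
    (hle : ∀ u v ℓ, R u v ℓ → ℓ ≤ δ)
    (wNM : ∀ u l, IsWalk R l u u → dcount l = 1 → dsum l ≤ xsum l)
    (wC₀ : ∀ u l, IsWalk R l u u → dcount l = 3 → (xsum l + dsum l) % 2 = 0 →
      dsum l < C₀ + xsum l)
    (wC₁ : ∀ u l, IsWalk R l u u → dcount l = 3 → (xsum l + dsum l) % 2 = 1 →
      dsum l < C₁ + xsum l)
    (wK₁ : ∀ u l, IsWalk R l u u → dcount l = 0 → xsum l % 2 = 1 → 2 * K ≤ xsum l)
    (wK₂ : ∀ u l, IsWalk R l u u → dcount l = 2 → (xsum l + dsum l) % 2 = 1 →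
      dsum l ≤ 2 * K + xsum l)
    (wK₂' : ∀ u l, IsWalk R l u u → dcount l = 4 → (xsum l + dsum l) % 2 = 1 →
      dsum l ≤ 6 * K + xsum l)
    (wP : δ = 5 → ∀ u l, IsWalk R l u u → dcount l = 5 → xsum l = 0 → dsum l ≠ 25) :
    ∃ d, InClassA δ K K C₀ C₁ d ∧ ∀ u v ℓ, R u v ℓ → d u v = ℓ := by
  classical
  have hB := boundSystem_metric hsymm hpos hle
  obtain ⟨d, hd⟩ := exists_isClamp_metric hsymm hB K wNM
  have sym := hd.symm hB
  have tri := hd.triangle hB (by omega) (by omega)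
  have dia := hd.le_diam hB (by omega)
  have zero := hd.eq_zero_iff hB (by omega)
  -- The bad pairs: a triangle `(δ, δ, K)` has the odd perimeter `2 * δ + K = 4 * K + 1 = C₁`.
  set S : V → V → Prop := fun u v => d u v = K ∧ ∃ w, d u w = δ ∧ d w v = δ
  have S_symm : ∀ u v, S u v → S v u := by
    rintro u v ⟨h, w, h1, h2⟩
    exact ⟨by rw [sym, h], w, by rw [sym, h2], by rw [sym, h1]⟩
  have S_walk : ∀ u v, S u v → ∃ l, IsWalk R l u v ∧ dcount l = 2 ∧ 2 * δ + xsum l = dsum l := by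
    rintro u v ⟨-, w, h1, h2⟩
    obtain ⟨l, h, e1, e2⟩ := hd.lo (u := u) (v := w) (by omega)
    obtain ⟨l', h', e1', e2'⟩ := hd.lo (u := w) (v := v) (by omega)
    exact ⟨l ++ l', h.append h', by simp; omega, by simp; omega⟩
  -- Neither bound of a bad pair is attained at `K`: an upper bound `K` would close up with the two
  -- `δ`-sides to a `K₂`-violation, a lower bound `K` to a `C₁`-violation. So `K - 1` respects all
  -- bounds, and no given edge is changed.
  have S_up : ∀ u v a, S u v → UpMetric R u v a → K < a := by
    intro u v a hs ha
    have h1 := hd.le_up ha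
    rw [hs.1] at h1
    refine lt_of_le_of_ne h1 ?_
    rintro rfl
    obtain ⟨l, h, e1, e2⟩ := S_walk u v hs
    obtain ⟨l', h', e1', e2'⟩ := ha
    have h0 := dsum_eq_zero_of_dcount _ e1'
    have := wK₂ u _ (h.append (h'.reverse hsymm)) (by simp; omega) (by simp; omega)
    simp at this
    omega
  have S_lo : ∀ u v b, S u v → LoMetric R u v b → b < K := by
    intro u v b hs hb
    have h1 := hd.lo_le hb
    rw [hs.1] at h1
    refine lt_of_le_of_ne h1 ?_
    rintro rfl
    obtain ⟨l, h, e1, e2⟩ := S_walk u v hs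
    obtain ⟨l', h', e1', e2'⟩ := hb
    have := wC₁ u _ (h.append (h'.reverse hsymm)) (by simp; omega) (by simp; omega)
    simp at this
    omega
  have one : ∀ u v w, S u v → v ≠ w → u ≠ w → TriangleOK K C₀ C₁ (K - 1) (d v w) (d u w) := by
    intro u v w hs hvw huw
    have side : ∀ u v w, S u v → v ≠ w → d u w ≤ d v w + (K - 1) := by
      intro u v w hs hvw
      have p : d v w ≠ 0 := fun h => hvw ((zero _ _).1 h)
      by_contra! hcon
      have hu := dia u w
      have h1 : LoMetric R u v (d u w - d v w) := by
        refine hB.lo_trans (a := d v w) ?_ (hB.up_symm (hd.up (by omega)))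
        rw [Nat.sub_add_cancel (by omega)]
        exact hd.lo (by omega)
      have := S_lo _ _ _ hs h1
      omega
    have t1 := side u v w hs hvw
    have t2 := side v u w (S_symm _ _ hs) huw
    have t3 := tri u w v
    rw [sym w v, hs.1] at t3
    have p1 : d v w ≠ 0 := fun h => hvw ((zero _ _).1 h)
    have p2 : d u w ≠ 0 := fun h => huw ((zero _ _).1 h)
    have b1 := dia v w
    have b2 := dia u w
    have k2 : (K - 1 + d v w + d u w) % 2 = 1 → d v w + d u w ≤ 3 * K - 1 := by
      intro ho
      by_contra! hcon
      obtain ⟨l, h, e1, e2⟩ := S_walk u v hs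
      obtain ⟨l', h', e1', e2'⟩ := hd.lo (u := v) (v := w) (by omega)
      obtain ⟨l'', h'', e1'', e2''⟩ := hd.lo (u := u) (v := w) (by omega)
      have := wK₂' u _ ((h.append h').append (h''.reverse hsymm)) (by simp; omega)
        (by simp; omega)
      simp at this
      omega
    have k1 : (K - 1 + d v w + d u w) % 2 = 1 → 2 * K ≤ K - 1 + d v w + d u w := by
      intro ho
      by_contra! hcon
      have := S_up u v _ hs (hB.up_trans (hd.up (u := u) (v := w) (by omega))
        (hB.up_symm (hd.up (u := v) (v := w) (by omega))))
      omega
    refine ⟨by omega, by omega, by omega, fun ho => ?_, fun ho => by omega⟩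
    have := k1 ho
    have := k2 ho
    refine ⟨by omega, by omega, by omega, by omega, by omega⟩
  have two : ∀ u v w, S u v → S v w → u ≠ w → TriangleOK K C₀ C₁ (K - 1) (K - 1) (d u w) := by
    intro u v w h1 h2 huw
    have hu := dia u w
    have p2 : d u w ≠ 0 := fun h => huw ((zero _ _).1 h)
    obtain ⟨l, h, e1, e2⟩ := S_walk u v h1
    obtain ⟨l', h', e1', e2'⟩ := S_walk v w h2
    -- From `2 * K - 1 ≤ d u w ≤ δ` it follows that `K = 3` and `d u w = δ = 5`. The two pairs of
    -- `δ`-sides behind the bad pairs then close up to five flagged labels `5` with no unflagged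
    -- edge.
    have c1 : d u w ≤ 2 * K - 2 := by
      by_contra! hcon
      have h5 : δ = 5 := by omega
      obtain ⟨l'', h'', e1'', e2''⟩ := hd.lo (u := u) (v := w) (by omega)
      have g1 := h.dsum_le hle
      have g2 := h'.dsum_le hle
      have g3 := h''.dsum_le hle
      rw [e1] at g1
      rw [e1'] at g2
      rw [e1''] at g3
      exact wP h5 u _ ((h.append h').append (h''.reverse hsymm)) (by simp; omega)
        (by simp; omega) (by simp; omega)
    -- A side `1` would close four sides `δ` to an odd walk with `4 * δ - 1 = 6 * K + 1`.
    have c2 : d u w ≠ 1 := by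
      intro hcon
      obtain ⟨l'', h'', e1'', e2''⟩ := hd.up (u := u) (v := w) (by omega)
      have := dsum_eq_zero_of_dcount _ e1''
      have := wK₂' u _ ((h.append h').append (h''.reverse hsymm)) (by simp; omega)
        (by simp; omega)
      simp at this
      omega
    refine ⟨by omega, by omega, by omega, fun ho => ?_, fun ho => by omega⟩
    refine ⟨by omega, by omega, by omega, by omega, by omega⟩
  have none_aux : ∀ u v w, ¬ S u w →
      ((d u v + d v w + d u w) % 2 = 1 → d u v + d v w ≤ 2 * K + d u w) := by
    intro u v w hs ho
    by_contra! hcon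
    have b1 := dia u v
    have b2 := dia v w
    -- Equality forces `d u v + d v w > 3 * K`, hence both equal to `δ`, and the pair would be bad.
    have hne : d u w ≠ K := fun he => hs ⟨he, v, by omega, by omega⟩
    have t2 := tri v u w
    have t3 := tri u w v
    rw [sym v u] at t2
    rw [sym w v] at t3
    have l1 : K < d u v := by clear ho; omega
    have l2 : K < d v w := by clear ho; omega
    have l3 : d u w < K := by clear ho; omega
    have := hd.metric_add_le hsymm wK₂ l1 l2 l3 ho
    omega
  have none_C : ∀ u v w, ¬ S u w → C₁ ≤ d u v + d v w + d u w → d u w ≠ K := by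
    intro u v w hs hC h
    have b1 := dia u v
    have b2 := dia v w
    exact hs ⟨h, v, by omega, by omega⟩
  have none : ∀ u v w, ¬ S u v → ¬ S v w → ¬ S u w →
      TriangleOK K C₀ C₁ (d u v) (d v w) (d u w) := by
    intro u v w s1 s2 s3
    have t1 := tri u v w
    have t2 := tri v u w
    have t3 := tri u w v
    have e1 := sym v u
    have e2 := sym w v
    rw [e1] at t2
    rw [e2] at t3
    have b1 := dia u v
    have b2 := dia v w
    have b3 := dia u w
    refine ⟨by omega, by omega, by omega, fun ho => ⟨?_, ?_, ?_, ?_, ?_⟩, fun ho => ?_⟩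
    · by_contra! hcon
      have := hd.metric_le_perimeter hsymm wK₁ (u := u) (v := v) (w := w) (by omega) (by omega)
        (by omega) ho
      omega
    · exact none_aux u v w s3 ho
    · have := none_aux v u w s2 (by rw [e1]; omega)
      omega
    · have := none_aux u w v s1 (by rw [e2]; omega)
      omega
    · by_contra! hcon
      have n1 := none_C u v w s3 hcon
      have n2 := none_C v u w s2 (by omega)
      have n3 := none_C u w v s1 (by omega)
      have l1 : K < d u v := by clear ho; omega
      have l2 : K < d v w := by clear ho; omega
      have l3 : K < d u w := by clear ho; omega
      have := hd.metric_perimeter_lt hsymm wC₁ l1 l2 l3 ho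
      omega
    · by_contra! hcon
      have l1 : K < d u v := by clear ho; omega
      have l2 : K < d v w := by clear ho; omega
      have l3 : K < d u w := by clear ho; omega
      have := hd.metric_perimeter_lt hsymm wC₀ l1 l2 l3 ho
      omega
  set e : V → V → ℕ := fun u v => if S u v then K - 1 else d u v
  have e_S : ∀ {u v}, S u v → e u v = K - 1 := fun h => if_pos h
  have e_nS : ∀ {u v}, ¬ S u v → e u v = d u v := fun h => if_neg h
  have e_symm : ∀ u v, e u v = e v u := by
    intro u v
    by_cases h : S u v
    · rw [e_S h, e_S (S_symm _ _ h)]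
    · rw [e_nS h, e_nS fun h' => h (S_symm _ _ h'), sym]
  have e_zero : ∀ u v, e u v = 0 ↔ u = v := by
    intro u v
    rw [← zero u v]
    by_cases h : S u v
    · rw [e_S h, h.1]
      omega
    · rw [e_nS h]
  have e_dia : ∀ u v, e u v ≤ δ := by
    intro u v
    by_cases h : S u v
    · rw [e_S h]
      omega
    · rw [e_nS h]
      exact dia u v
  have ok : ∀ u v w, TriangleOK K C₀ C₁ (e u v) (e v w) (e u w) := by
    intro u v w
    have degenerate : ∀ a, a ≤ δ → TriangleOK K C₀ C₁ 0 a a := by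
      intro a ha
      refine ⟨by omega, by omega, by omega, fun ho => by omega, fun ho => by omega⟩
    rcases eq_or_ne u v with rfl | huv
    · rw [(e_zero u u).2 rfl]
      exact degenerate _ (e_dia _ _)
    rcases eq_or_ne v w with rfl | hvw
    · rw [(e_zero v v).2 rfl]
      exact (degenerate _ (e_dia _ _)).swap
    rcases eq_or_ne u w with rfl | huw
    · rw [(e_zero u u).2 rfl, e_symm v u]
      exact (degenerate _ (e_dia _ _)).rotate
    by_cases s1 : S u v <;> by_cases s2 : S v w <;> by_cases s3 : S u w
    · rw [e_S s1, e_S s2, e_S s3]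
      -- `K` is odd because `2 * δ = 3 * K + 1`, so the perimeter `3 * (K - 1)` is even.
      refine ⟨by omega, by omega, by omega, fun ho => by omega, fun ho => by omega⟩
    · rw [e_S s1, e_S s2, e_nS s3]
      exact two u v w s1 s2 huw
    · rw [e_S s1, e_nS s2, e_S s3]
      exact (two v u w (S_symm _ _ s1) s3 hvw).rotate
    · rw [e_S s1, e_nS s2, e_nS s3]
      exact one u v w s1 hvw huw
    · rw [e_nS s1, e_S s2, e_S s3]
      have := two u w v s3 (S_symm _ _ s2) huv
      exact this.rotate.rotate
    · rw [e_nS s1, e_S s2, e_nS s3]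
      have := one v w u s2 huw.symm huv.symm
      rw [sym w u, sym v u] at this
      exact this.rotate.rotate
    · rw [e_nS s1, e_nS s2, e_S s3]
      have := one u w v s3 hvw.symm huv
      rw [sym w v] at this
      exact this.rotate.swap
    · rw [e_nS s1, e_nS s2, e_nS s3]
      exact none u v w s1 s2 s3
  refine ⟨e, InClassA.of_triangles e_zero e_symm (fun u v w => (ok u v w).2.2.1) e_dia
    (fun u v w ho => ((ok u v w).2.2.2.1 ho).1) (fun u v w ho => ((ok u v w).2.2.2.1 ho).2.1)
    (fun u v w _ _ _ ho => ((ok u v w).2.2.2.1 ho).2.2.2.2)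
    (fun u v w _ _ _ ho => (ok u v w).2.2.2.2 ho), ?_⟩
  intro u v ℓ h
  have h1 : d u v = ℓ := hd.eq_of_edge hB h
  by_cases hs : S u v
  · have := S_up u v _ hs (hB.up_edge h)
    rw [← h1, hs.1] at this
    omega
  · rw [e_nS hs, h1]

end MetricCompletion

/-! ### Forbidden cycles as conditions on closed walks -/

section ForbWalks

open LabelledCycle

variable {δ : ℕ} {V : Type*} {G : EdgeLabelledGraph δ V}

/-- Cycles have at least three edges, so shorter closed walks are treated apart: without loops they
are empty or run along one edge and back. -/
theorem IsWalk.short {l : List (ℕ × Bool)} {u : V} (h : IsWalk G.HasEdge l u u)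
    (hl : l.length < 3) :
    (xsum l + dsum l) % 2 = 0 ∧ (dcount l = 1 → dsum l ≤ xsum l) ∧ dcount l ≤ 2 := by
  obtain _ | ⟨⟨a, s⟩, _ | ⟨⟨b, t⟩, _ | ⟨e, l⟩⟩⟩ := l
  · simp
  · obtain ⟨v, hv, rfl⟩ := h
    exact absurd rfl hv.ne
  · obtain ⟨v, hv, w, hw, rfl⟩ := h
    have : a = b := hv.unique hw.symm
    subst this
    cases s <;> cases t <;> simp <;> omega
  · simp at hl
    omega

theorem Forb.exists_notMem {F : Set (LabelledCycle δ)} (hG : G ∈ Forb F V)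
    {l : List (ℕ × Bool)} {u : V} (h : IsWalk G.HasEdge l u u) (h3 : 3 ≤ l.length) :
    ∃ (c : LabelledCycle δ) (s : Finset (Fin (c.extra + 3))), c ∉ F ∧ s.card = dcount l ∧
      ∑ i ∈ s, c.len i = dsum l ∧ ∑ i ∈ sᶜ, c.len i = xsum l ∧
      c.perimeter = xsum l + dsum l ∧ c.extra + 3 = l.length ∧ ∀ i, ∃ b, (c.len i, b) ∈ l := by
  obtain ⟨c, f, s, hf, h⟩ := exists_isHom_of_isWalk G h h3
  exact ⟨c, s, fun hc => hG c hc ⟨f, hf⟩, h⟩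

theorem Forb.dsum_le_xsum {F : Set (LabelledCycle δ)} (hG : G ∈ Forb F V)
    (hF : nonMetric δ ⊆ F) (u : V) (l : List (ℕ × Bool)) (h : IsWalk G.HasEdge l u u)
    (hl : dcount l = 1) : dsum l ≤ xsum l := by
  rcases lt_or_ge l.length 3 with h3 | h3
  · exact (h.short h3).2.1 hl
  obtain ⟨c, s, hc, e1, e2, e3, -⟩ := Forb.exists_notMem hG h h3
  by_contra! hcon
  rw [hl, Finset.card_eq_one] at e1
  obtain ⟨a, rfl⟩ := e1
  rw [Finset.sum_singleton] at e2
  exact hc (hF ⟨a, by omega⟩)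

theorem Forb.dsum_le_of_cCycles {C : ℕ} {F : Set (LabelledCycle δ)} (hG : G ∈ Forb F V)
    (hF : cCycles δ C ⊆ F) (u : V) (l : List (ℕ × Bool)) (n : ℕ) (h : IsWalk G.HasEdge l u u)
    (hl : dcount l = 2 * n + 1) : dsum l ≤ n * (C - 1) + xsum l := by
  rcases lt_or_ge l.length 3 with h3 | h3
  · have := h.short h3
    omega
  obtain ⟨c, s, hc, e1, e2, e3, -⟩ := Forb.exists_notMem hG h h3
  by_contra! hcon
  exact hc (hF ⟨n, s, by omega, by omega⟩)

theorem Forb.dsum_lt_of_c₀Cycles {C₀ : ℕ} {F : Set (LabelledCycle δ)} (hG : G ∈ Forb F V)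
    (hF : c₀Cycles δ C₀ ⊆ F) (hC₀ : 0 < C₀) (u : V) (l : List (ℕ × Bool))
    (h : IsWalk G.HasEdge l u u) (hl : dcount l = 3) (ho : (xsum l + dsum l) % 2 = 0) :
    dsum l < C₀ + xsum l := by
  rcases lt_or_ge l.length 3 with h3 | h3
  · have := h.short h3
    omega
  obtain ⟨c, s, hc, e1, e2, e3, e4, -⟩ := Forb.exists_notMem hG h h3
  by_contra! hcon
  exact hc (hF ⟨Nat.even_iff.2 (by omega), 1, s, Or.inr rfl, by omega, by omega⟩)

theorem Forb.dsum_lt_of_c₁Cycles {C₁ : ℕ} {F : Set (LabelledCycle δ)} (hG : G ∈ Forb F V)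
    (hF : c₁Cycles δ C₁ ⊆ F) (hC₁ : 0 < C₁) (u : V) (l : List (ℕ × Bool))
    (h : IsWalk G.HasEdge l u u) (hl : dcount l = 3) (ho : (xsum l + dsum l) % 2 = 1) :
    dsum l < C₁ + xsum l := by
  rcases lt_or_ge l.length 3 with h3 | h3
  · have := h.short h3
    omega
  obtain ⟨c, s, hc, e1, e2, e3, e4, -⟩ := Forb.exists_notMem hG h h3
  by_contra! hcon
  exact hc (hF ⟨Nat.odd_iff.2 (by omega), 1, s, Or.inr rfl, by omega, by omega⟩)

theorem Forb.le_xsum_of_k₁Cycles {K₁ : ℕ} {F : Set (LabelledCycle δ)} (hG : G ∈ Forb F V)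
    (hF : nonMetric δ ⊆ F) (hF' : k₁Cycles δ K₁ ⊆ F) (u : V) (l : List (ℕ × Bool))
    (h : IsWalk G.HasEdge l u u) (hl : dcount l = 0) (ho : xsum l % 2 = 1) :
    2 * K₁ ≤ xsum l := by
  have h0 := dsum_eq_zero_of_dcount _ hl
  rcases lt_or_ge l.length 3 with h3 | h3
  · have := h.short h3
    omega
  obtain ⟨c, s, hc, e1, e2, e3, e4, -⟩ := Forb.exists_notMem hG h h3
  by_contra! hcon
  exact hc (hF' ⟨fun h' => hc (hF h'), Nat.odd_iff.2 (by omega), by omega⟩)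

theorem Forb.dsum_le_of_k₂Cycles {K₂ C : ℕ} {F : Set (LabelledCycle δ)} (hG : G ∈ Forb F V)
    (hF : k₂Cycles δ K₂ C ⊆ F) (u : V) (l : List (ℕ × Bool)) (n : ℕ)
    (h : IsWalk G.HasEdge l u u) (hl : dcount l = 2 * n + 2) (ho : (xsum l + dsum l) % 2 = 1) :
    dsum l ≤ 2 * K₂ + n * (C - 1) + xsum l := by
  rcases lt_or_ge l.length 3 with h3 | h3
  · have := h.short h3
    omega
  obtain ⟨c, s, hc, e1, e2, e3, e4, -⟩ := Forb.exists_notMem hG h h3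
  by_contra! hcon
  exact hc (hF ⟨Nat.odd_iff.2 (by omega), n, s, by omega, by omega⟩)

theorem IsWalk.mem_label {l : List (ℕ × Bool)} {u w : V} (h : IsWalk G.HasEdge l u w) :
    ∀ e ∈ l, 1 ≤ e.1 ∧ e.1 ≤ δ := by
  induction l generalizing u with
  | nil => simp
  | cons e l ih =>
    obtain ⟨v, hv, h⟩ := h
    rintro x (_ | ⟨_, hx⟩)
    · exact hv.mem
    · exact ih h x hx

theorem eq_of_dsum_eq_length_mul {l : List (ℕ × Bool)} (h : ∀ e ∈ l, 1 ≤ e.1 ∧ e.1 ≤ δ)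
    (hx : xsum l = 0) : dcount l = l.length ∧ dsum l ≤ l.length * δ ∧
      (l.length * δ ≤ dsum l → ∀ e ∈ l, e.1 = δ) := by
  induction l with
  | nil => simp
  | cons e l ih =>
    obtain ⟨a, _ | _⟩ := e
    · have := h (a, false) (by simp)
      simp at hx this
      omega
    · have h1 := h (a, true) (by simp)
      obtain ⟨i1, i2, i3⟩ := ih (fun e he => h e (List.mem_cons_of_mem _ he)) (by simpa using hx)
      simp only [dcount_cons_true, dsum_cons_true, List.length_cons, add_mul, one_mul] at *
      refine ⟨by omega, by omega, fun hle => ?_⟩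
      rintro x (_ | ⟨_, hx⟩)
      · change a = δ
        omega
      · exact i3 (by omega) x hx

theorem Forb.dsum_ne_of_fiveFives {F : Set (LabelledCycle δ)} (hG : G ∈ Forb F V)
    (hF : fiveFives δ ⊆ F) (hδ : δ = 5) (u : V) (l : List (ℕ × Bool))
    (h : IsWalk G.HasEdge l u u) (hl : dcount l = 5) (hx : xsum l = 0) : dsum l ≠ 25 := by
  intro hd
  obtain ⟨i1, i2, i3⟩ := eq_of_dsum_eq_length_mul h.mem_label hx
  obtain ⟨c, s, hc, e1, e2, e3, e4, e5, e6⟩ := Forb.exists_notMem hG h (by omega)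
  refine hc (hF ⟨by omega, fun i => ?_⟩)
  obtain ⟨b, hb⟩ := e6 i
  have := i3 (by rw [← i1, hl, hd, hδ]) _ hb
  exact this.trans hδ

theorem mem_completable_of_exists {K₁ K₂ C₀ C₁ : ℕ}
    (h : ∃ d, InClassA δ K₁ K₂ C₀ C₁ d ∧ ∀ u v ℓ, G.HasEdge u v ℓ → d u v = ℓ) :
    G ∈ completable δ K₁ K₂ C₀ C₁ V := by
  obtain ⟨d, hA, hd⟩ := h
  exact ⟨d, hA, fun u v h => hd u v _ ⟨h, rfl⟩⟩

end ForbWalks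

/-! ### Necessity: spaces of the class contain no forbidden cycle -/

section Necessity

open LabelledCycle

variable {δ K₁ K₂ C₀ C₁ : ℕ} {V : Type*} {d : V → V → ℕ}

/-- The metric space `d` contains a homomorphic image of the cycle `c`. -/
def MapsTo (c : LabelledCycle δ) (d : V → V → ℕ) : Prop :=
  ∀ s : Finset (Fin (c.extra + 3)), ∃ u l, IsDistWalk d l u u ∧ dcount l = s.card ∧
    dsum l = ∑ i ∈ s, c.len i ∧ xsum l = ∑ i ∈ sᶜ, c.len i ∧ xsum l + dsum l = c.perimeter

theorem completable_subset_forb {F : Set (LabelledCycle δ)}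
    (h : ∀ d : V → V → ℕ, InClassA δ K₁ K₂ C₀ C₁ d → ∀ c ∈ F, MapsTo c d →
      (∃ f : Fin (c.extra + 3) → V, ∀ i, d (f i) (f (i + 1)) = c.len i) → False) :
    completable δ K₁ K₂ C₀ C₁ V ⊆ Forb F V := by
  rintro G ⟨d, hA, hd⟩ c hc ⟨f, hf⟩
  have hE : ∀ u v ℓ, G.HasEdge u v ℓ → d u v = ℓ := by
    rintro u v ℓ ⟨h, rfl⟩
    exact hd u v h
  refine h d hA c hc (fun s => ?_) ⟨f, fun i => hE _ _ _ ((isHom_iff c G f).1 hf i)⟩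
  obtain ⟨u, l, hl, h⟩ := exists_isWalk_of_isHom c G f hf s
  exact ⟨u, l, hl.mono hE, h⟩

namespace InClassA

theorem not_nonMetric (hA : InClassA δ K₁ K₂ C₀ C₁ d) {c : LabelledCycle δ} (hm : MapsTo c d) :
    c ∉ nonMetric δ := by
  rintro ⟨a, ha⟩
  obtain ⟨u, l, hl, h1, h2, h3, -⟩ := hm {a}
  have hp : ∀ u v w, d u v + d v w + d u w ≤ 3 * δ := by
    intro u v w
    have := hA.le_diam u v
    have := hA.le_diam v w
    have := hA.le_diam u w
    omega
  have := (IsDistWalk.bound hA.self hA.symm hA.triangle hp hl 0).2 (by simpa using h1)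
  rw [hA.self] at this
  rw [Finset.sum_singleton] at h2
  omega

theorem not_cCycles (hA : InClassA δ K₁ K₂ C₀ C₁ d) {C : ℕ}
    (hp : ∀ u v w, d u v + d v w + d u w ≤ C - 1) {c : LabelledCycle δ} (hm : MapsTo c d) :
    c ∉ cCycles δ C := by
  rintro ⟨n, s, hs, hlt⟩
  obtain ⟨u, l, hl, h1, h2, h3, -⟩ := hm s
  have := (IsDistWalk.bound hA.self hA.symm hA.triangle hp hl n).2 (by omega)
  rw [hA.self] at this
  omega

theorem not_k₁Cycles (hA : InClassA δ K₁ K₂ C₀ C₁ d) {c : LabelledCycle δ} (hm : MapsTo c d) :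
    c ∉ k₁Cycles δ K₁ := by
  rintro ⟨-, ho, hlt⟩
  rw [Nat.odd_iff] at ho
  obtain ⟨u, l, hl, h1, h2, h3, h4⟩ := hm ∅
  have := (IsDistWalk.parity_or_K₁ (K₁ := K₁) hA.self hA.symm hA.triangle
    (fun u v w h => (hA.odd_triangle u v w h).1) hl).2
  rw [hA.self] at this
  omega

theorem not_c₀Cycles (hA : InClassA δ K₁ K₂ C₀ C₁ d) (hC₀ : 2 * δ + 2 ≤ C₀)
    (hC : 2 * δ + K₂ ≤ C₀) {c : LabelledCycle δ} (hm : MapsTo c d) : c ∉ c₀Cycles δ C₀ := by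
  rintro ⟨ho, n, s, rfl | rfl, hs, hlt⟩
  · obtain ⟨a, rfl⟩ := Finset.card_eq_one.1 hs
    exact hA.not_nonMetric hm ⟨a, by simpa using hlt⟩
  rw [Nat.even_iff] at ho
  obtain ⟨u, l, hl, h1, h2, h3, h4⟩ := hm s
  have := IsDistWalk.C_three hA.symm hA.triangle
    (fun u v w h => (hA.odd_triangle u v w h).2.2.2.1) hA.le_diam hC 0
    (fun u v w h => hA.even_triangle hC₀ u v w h) hl (by omega) (by omega)
  omega

theorem not_c₁Cycles (hA : InClassA δ K₁ K₂ C₀ C₁ d)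
    (hC : 2 * δ + K₂ ≤ C₁) {c : LabelledCycle δ} (hm : MapsTo c d) : c ∉ c₁Cycles δ C₁ := by
  rintro ⟨ho, n, s, rfl | rfl, hs, hlt⟩
  · obtain ⟨a, rfl⟩ := Finset.card_eq_one.1 hs
    exact hA.not_nonMetric hm ⟨a, by simpa using hlt⟩
  rw [Nat.odd_iff] at ho
  obtain ⟨u, l, hl, h1, h2, h3, h4⟩ := hm s
  have := IsDistWalk.C_three hA.symm hA.triangle
    (fun u v w h => (hA.odd_triangle u v w h).2.2.2.1) hA.le_diam hC 1
    (fun u v w h => (hA.odd_triangle u v w h).2.1) hl (by omega) (by omega)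
  omega

/-- For `C` large enough, only the case `n = 0` of the `K₂`-cycles is not vacuous. -/
theorem not_k₂Cycles_of_large (hA : InClassA δ K₁ K₂ C₀ C₁ d) {C : ℕ} (hC : 2 * δ + 2 ≤ C)
    (hC' : 4 * δ + 1 ≤ 2 * K₂ + C) {c : LabelledCycle δ} (hm : MapsTo c d) :
    c ∉ k₂Cycles δ K₂ C := by
  rintro ⟨ho, n, s, hs, hlt⟩
  rw [Nat.odd_iff] at ho
  obtain ⟨u, l, hl, h1, h2, h3, h4⟩ := hm s
  obtain _ | n := n
  · have := IsDistWalk.K₂_two hA.symm hA.triangle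
      (fun u v w h => (hA.odd_triangle u v w h).2.2.2.1) hl (by omega) (by omega)
    omega
  · have hd := hl.dsum_le (δ := δ) (by rintro u v ℓ rfl; exact hA.le_diam u v)
    rw [h1, hs] at hd
    obtain ⟨N, rfl⟩ : ∃ N, C = N + 1 := ⟨C - 1, by omega⟩
    rw [Nat.add_sub_cancel] at hlt
    have h6 : n * (2 * δ) ≤ n * N := Nat.mul_le_mul_left _ (by omega)
    have h7 : (n + 1) * N = n * N + N := by ring
    have h8 : (2 * (n + 1) + 2) * δ = n * (2 * δ) + 4 * δ := by ring
    omega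

/-- Replacing two sides `e` of a triangle by `K₁ + K₂ - e` turns the `K₂` inequality into the `K₁`
inequality and the perimeter bound into a triangle inequality. A `K₂`-cycle becomes an odd closed
walk shorter than `2 * K₁`. -/
theorem not_k₂Cycles_of_antipodal (hA : InClassA δ K₁ K₂ C₀ C₁ d) {C : ℕ}
    (hC : C = 2 * K₁ + 2 * K₂ + 1) (hp : ∀ u v w, d u v + d v w + d u w ≤ C - 1)
    {c : LabelledCycle δ} (hm : MapsTo c d) : c ∉ k₂Cycles δ K₂ C := by
  rintro ⟨ho, n, s, hs, hlt⟩
  rw [Nat.odd_iff] at ho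
  obtain ⟨u, l, hl, h1, h2, h3, h4⟩ := hm s
  have hN : C - 1 = 2 * K₁ + 2 * K₂ := by omega
  have := (IsDistWalk.parity_or_antipodal hN hA.self hA.symm hA.triangle hp (fun u v w h => by
    have := hA.odd_triangle u v w h
    omega) hl (n + 1)).1 (by omega)
  rw [hA.self] at this
  have h7 : (n + 1) * (C - 1) = n * (C - 1) + (C - 1) := by ring
  omega

theorem not_k₂Cycles_of_caseIIB {K : ℕ} (hA : InClassA δ K K C₀ (4 * K + 1) d)
    (hδ : 2 * δ = 3 * K + 1) (hK : 3 ≤ K) {c : LabelledCycle δ} (hm : MapsTo c d) :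
    c ∉ k₂Cycles δ K (4 * K + 1) := by
  rintro ⟨ho, n, s, hs, hlt⟩
  rw [Nat.odd_iff] at ho
  obtain ⟨u, l, hl, h1, h2, h3, h4⟩ := hm s
  rw [Nat.add_sub_cancel] at hlt
  obtain _ | _ | n := n
  · have := IsDistWalk.K₂_two hA.symm hA.triangle
      (fun u v w h => (hA.odd_triangle u v w h).2.2.2.1) hl (by omega) (by omega)
    omega
  · have := IsDistWalk.K₂_four hA.symm hA.triangle
      (fun u v w h => (hA.odd_triangle u v w h).2.2.2.1) hA.le_diam hδ
      (fun u v w h => Nat.lt_succ_iff.1 (hA.odd_triangle u v w h).2.1) hl (by omega) (by omega)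
    omega
  -- With six or more flags the cycle cannot exist, because `6 * δ = 9 * K + 3 ≤ 10 * K`; this is
  -- where `3 ≤ K` enters.
  · have hd := hl.dsum_le (δ := δ) (by rintro u v ℓ rfl; exact hA.le_diam u v)
    rw [h1, hs] at hd
    have h6 : n * (2 * δ) ≤ n * (4 * K) := Nat.mul_le_mul_left _ (by omega)
    have h7 : (n + 1 + 1) * (4 * K) = n * (4 * K) + 8 * K := by ring
    have h8 : (2 * (n + 1 + 1) + 2) * δ = n * (2 * δ) + 6 * δ := by ring
    omega

theorem not_fiveFives (hA : InClassA 5 3 3 C₀ 13 d) {c : LabelledCycle 5}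
    (hf : ∃ f : Fin (c.extra + 3) → V, ∀ i, d (f i) (f (i + 1)) = c.len i) :
    c ∉ fiveFives 5 := by
  rintro ⟨h5, hc⟩
  obtain ⟨m, g⟩ := c
  obtain rfl : m = 2 := by simpa using h5
  obtain ⟨f, hf⟩ := hf
  have e (i : Fin 5) : d (f i) (f (i + 1)) = 5 := (hf i).trans (hc i)
  have e0 : d (f 0) (f 1) = 5 := e 0
  have e1 : d (f 1) (f 2) = 5 := e 1
  have e2 : d (f 2) (f 3) = 5 := e 2
  have e3 : d (f 3) (f 4) = 5 := e 3
  have e4 : d (f 4) (f 0) = 5 :=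
    (congrArg (fun i : Fin 5 => d (f 4) (f i)) (show (0 : Fin 5) = 4 + 1 by decide)).trans (e 4)
  have h1 := hA.odd_triangle (f 0) (f 1) (f 2)
  have h2 := hA.odd_triangle (f 2) (f 3) (f 4)
  have h3 := hA.odd_triangle (f 0) (f 2) (f 4)
  have h4 := hA.triangle (f 0) (f 2) (f 4)
  rw [hA.symm (f 0) (f 4)] at h3 h4
  -- The diagonals `d (f 0) (f 2)` and `d (f 2) (f 4)` must be even. The odd triangle they form with
  -- the side `5` makes them equal, with sum at least `5` and at most `7`, which is impossible.
  omega

end InClassA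

end Necessity

/-! ### Choice of `M` in each case, and the theorem -/

section Main

open LabelledCycle

variable {δ K₁ K₂ C₀ C₁ : ℕ} {V : Type*}

theorem completable_eq_forb_of_adjacent (hadm : Admissible δ K₁ K₂ C₀ C₁)
    (hC : max C₀ C₁ = min C₀ C₁ + 1) :
    completable δ K₁ K₂ C₀ C₁ V =
      Forb (nonMetric δ ∪ cCycles δ (min C₀ C₁) ∪ k₁Cycles δ K₁ ∪
        k₂Cycles δ K₂ (min C₀ C₁)) V := by
  obtain ⟨⟨a1, a2, a3, a4, a5, a6, a7, a8, a9, a10⟩, hcase⟩ := hadm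
  rw [Nat.even_iff] at a9
  rw [Nat.odd_iff] at a10
  have hcase' : (min C₀ C₁ = 2 * K₁ + 2 * K₂ + 1 ∧ K₁ + 2 * K₂ ≤ 2 * δ - 1) ∨
      CaseIII δ K₁ K₂ C₀ C₁ := by
    rcases hcase with ⟨⟨-, h, -, h'⟩, -⟩ | ⟨-, h, -⟩ | h
    · exact Or.inl ⟨h, h'⟩
    · omega
    · exact Or.inr h
  generalize hCm : min C₀ C₁ = C at *
  refine Set.Subset.antisymm (completable_subset_forb fun d hA c hc hm _ => ?_) fun G hG => ?_
  -- A perimeter equal to `C` would have the parity of `C`, and is excluded by the bound for that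
  -- parity; larger ones are excluded by either bound.
  · have hp : ∀ u v w, d u v + d v w + d u w ≤ C - 1 := by
      intro u v w
      have h1 := hA.odd_triangle u v w
      have h2 := hA.even_triangle a5 u v w
      omega
    rcases hc with ((hc | hc) | hc) | hc
    · exact hA.not_nonMetric hm hc
    · exact hA.not_cCycles hp hm hc
    · exact hA.not_k₁Cycles hm hc
    · rcases hcase' with ⟨h, -⟩ | ⟨h1, h2, h3, h4, h5⟩
      · exact hA.not_k₂Cycles_of_antipodal h hp hm hc
      · exact hA.not_k₂Cycles_of_large (by omega) (by omega) hm hc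
  · obtain ⟨M, hM0, hMδ, hδM, hMN, hM₁, hM₂, hM₃⟩ : ∃ M, 0 < M ∧ M ≤ δ ∧ δ ≤ 2 * M ∧
        2 * M + δ ≤ C - 1 ∧ K₁ ≤ M ∧ M ≤ K₂ ∧ (C - 1 = 2 * K₁ + 2 * K₂ ∨
          2 * δ + K₁ ≤ C - 1 ∧ 2 * δ ≤ 2 * K₂ + M ∧ 4 * δ ≤ 2 * K₂ + (C - 1)) := by
      rcases hcase' with ⟨h, h'⟩ | ⟨h1, h2, h3, h4, h5⟩
      · exact ⟨max K₁ ((δ + 1) / 2), by omega, by omega, by omega, by omega, by omega, by omega,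
          by omega⟩
      · by_cases h6 : K₁ + 2 * K₂ = 2 * δ - 1
        · have := h4 h6
          -- `M = K₁` would miss `2 * δ ≤ 2 * K₂ + M` by one; the extra room `2 * δ + K₁ + 2 ≤ C`
          -- permits `K₁ + 1`.
          exact ⟨max (K₁ + 1) ((δ + 1) / 2), by omega, by omega, by omega, by omega, by omega,
            by omega, by omega⟩
        · exact ⟨max K₁ ((δ + 1) / 2), by omega, by omega, by omega, by omega, by omega,
            by omega, by omega⟩
    have hF₀ : nonMetric δ ⊆ nonMetric δ ∪ cCycles δ C ∪ k₁Cycles δ K₁ ∪ k₂Cycles δ K₂ C :=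
      fun c hc => Or.inl (Or.inl (Or.inl hc))
    exact mem_completable_of_exists (exists_inClassA_of_adjacent (N := C - 1) (M := M)
      (fun u v ℓ h => h.symm) (fun u v ℓ h => h.mem.1) (fun u v ℓ h => h.mem.2) (by omega)
      hM0 hMδ hδM hMN hM₁ hM₂ (by omega) (by omega) hM₃
      (Forb.dsum_le_of_cCycles hG fun c hc => Or.inl (Or.inl (Or.inr hc)))
      (Forb.le_xsum_of_k₁Cycles hG hF₀ fun c hc => Or.inl (Or.inr hc))
      (Forb.dsum_le_of_k₂Cycles hG fun c hc => Or.inr hc))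

theorem completable_eq_forb_of_caseIII (hacc : Acceptable δ K₁ K₂ C₀ C₁)
    (hIII : CaseIII δ K₁ K₂ C₀ C₁) (hC : min C₀ C₁ + 1 < max C₀ C₁) :
    completable δ K₁ K₂ C₀ C₁ V =
      Forb (nonMetric δ ∪ c₀Cycles δ C₀ ∪ c₁Cycles δ C₁ ∪ k₁Cycles δ K₁ ∪
        k₂Cycles δ K₂ (min C₀ C₁)) V := by
  obtain ⟨a1, a2, a3, a4, a5, a6, a7, a8, a9, a10⟩ := hacc
  obtain ⟨h1, h2, h3, h4, h5⟩ := hIII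
  rw [Nat.even_iff] at a9
  rw [Nat.odd_iff] at a10
  have h6 := h5 hC
  refine Set.Subset.antisymm (completable_subset_forb fun d hA c hc hm _ => ?_) fun G hG => ?_
  · rcases hc with (((hc | hc) | hc) | hc) | hc
    · exact hA.not_nonMetric hm hc
    · exact hA.not_c₀Cycles a5 (by omega) hm hc
    · exact hA.not_c₁Cycles (by omega) hm hc
    · exact hA.not_k₁Cycles hm hc
    · exact hA.not_k₂Cycles_of_large (by omega) (by omega) hm hc
  · have hF₀ : nonMetric δ ⊆ nonMetric δ ∪ c₀Cycles δ C₀ ∪ c₁Cycles δ C₁ ∪ k₁Cycles δ K₁ ∪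
        k₂Cycles δ K₂ (min C₀ C₁) := fun c hc => Or.inl (Or.inl (Or.inl (Or.inl hc)))
    obtain ⟨M, hM0, hMδ, hδM, hMC, hM₁, hM₂, hM₃⟩ : ∃ M, 0 < M ∧ M ≤ δ ∧ δ ≤ 2 * M ∧
        2 * δ + M < min C₀ C₁ ∧ K₁ ≤ M ∧ M ≤ K₂ ∧ 2 * δ ≤ 2 * K₂ + M :=
      -- The largest `M` allowed by `M ≤ K₂` and `2 * δ + M < C`; as `2 * δ + K₂ ≤ C`, it is `K₂` or
      -- `K₂ - 1`.
      ⟨min K₂ (min C₀ C₁ - 1 - 2 * δ), by omega, by omega, by omega, by omega, by omega,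
        by omega, by omega⟩
    exact mem_completable_of_exists (exists_inClassA_of_large (M := M)
      (fun u v ℓ h => h.symm) (fun u v ℓ h => h.mem.1) (fun u v ℓ h => h.mem.2)
      hM0 hMδ hδM hM₁ hM₂ hM₃ (by omega) (by omega)
      (Forb.dsum_le_xsum hG hF₀)
      (Forb.dsum_lt_of_c₀Cycles hG (fun c hc => Or.inl (Or.inl (Or.inl (Or.inr hc)))) (by omega))
      (Forb.dsum_lt_of_c₁Cycles hG (fun c hc => Or.inl (Or.inl (Or.inr hc))) (by omega))
      (Forb.le_xsum_of_k₁Cycles hG hF₀ fun c hc => Or.inl (Or.inr hc))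
      (fun u l h hl ho => by
        have := Forb.dsum_le_of_k₂Cycles hG (fun c hc => Or.inr hc) u l 0 h hl ho
        omega))

/-- In Case IIB, the cycle `(5, 5, 5, 5, 5)` has to be forbidden if and only if `δ = 5`: it is the
only member of `P` in that case, and `P` is empty otherwise. -/
theorem completable_eq_forb_of_caseIIB (hacc : Acceptable δ K₁ K₂ C₀ C₁)
    (hIIB : CaseIIB δ K₁ K₂ C₀ C₁) (P : Set (LabelledCycle δ)) (hP : P ⊆ fiveFives δ)
    (hP' : P.Nonempty → δ = 5) (hP'' : δ = 5 → fiveFives δ ⊆ P) :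
    completable δ K₁ K₂ C₀ C₁ V =
      Forb (nonMetric δ ∪ c₀Cycles δ C₀ ∪ c₁Cycles δ C₁ ∪ k₁Cycles δ K₁ ∪
        k₂Cycles δ K₂ (min C₀ C₁) ∪ P) V := by
  obtain ⟨a1, a2, a3, a4, a5, a6, a7, a8, a9, a10⟩ := hacc
  obtain ⟨⟨h1, h2, h3, h4⟩, h5, rfl, h6⟩ := hIIB
  rw [Nat.even_iff] at a9
  rw [Nat.odd_iff] at a10
  obtain rfl : C₁ = 4 * K₁ + 1 := by omega
  have h7 : min C₀ (4 * K₁ + 1) = 4 * K₁ + 1 := by omega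
  rw [h7]
  have hK : 3 ≤ K₁ := by omega
  refine Set.Subset.antisymm (completable_subset_forb fun d hA c hc hm hf => ?_) fun G hG => ?_
  · rcases hc with ((((hc | hc) | hc) | hc) | hc) | hc
    · exact hA.not_nonMetric hm hc
    · exact hA.not_c₀Cycles a5 (by omega) hm hc
    · exact hA.not_c₁Cycles (by omega) hm hc
    · exact hA.not_k₁Cycles hm hc
    · exact hA.not_k₂Cycles_of_caseIIB (by omega) hK hm hc
    · obtain rfl : δ = 5 := hP' ⟨c, hc⟩
      obtain rfl : K₁ = 3 := by omega
      exact hA.not_fiveFives hf (hP hc)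
  · have hF₀ : nonMetric δ ⊆ nonMetric δ ∪ c₀Cycles δ C₀ ∪ c₁Cycles δ (4 * K₁ + 1) ∪
        k₁Cycles δ K₁ ∪ k₂Cycles δ K₁ (4 * K₁ + 1) ∪ P :=
      fun c hc => Or.inl (Or.inl (Or.inl (Or.inl (Or.inl hc))))
    have hK₂ := Forb.dsum_le_of_k₂Cycles hG (K₂ := K₁) (C := 4 * K₁ + 1)
      (fun c hc => Or.inl (Or.inr hc))
    exact mem_completable_of_exists (exists_inClassA_of_caseIIB (by omega) hK rfl (by omega)
      (fun u v ℓ h => h.symm) (fun u v ℓ h => h.mem.1) (fun u v ℓ h => h.mem.2)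
      (Forb.dsum_le_xsum hG hF₀)
      (Forb.dsum_lt_of_c₀Cycles hG
        (fun c hc => Or.inl (Or.inl (Or.inl (Or.inl (Or.inr hc))))) (by omega))
      (Forb.dsum_lt_of_c₁Cycles hG
        (fun c hc => Or.inl (Or.inl (Or.inl (Or.inr hc)))) (by omega))
      (Forb.le_xsum_of_k₁Cycles hG hF₀ fun c hc => Or.inl (Or.inl (Or.inr hc)))
      (fun u l h hl ho => by
        have := hK₂ u l 0 h hl ho
        omega)
      (fun u l h hl ho => by
        have := hK₂ u l 1 h hl ho
        omega)
      (fun h => Forb.dsum_ne_of_fiveFives hG (fun c hc => Or.inr (hP'' h hc)) h))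

end Main

theorem theorem1 (δ K₁ K₂ C₀ C₁ : ℕ) (hadm : Admissible δ K₁ K₂ C₀ C₁)
    (V : Type*) [Finite V] :
    (|(C₀ : ℤ) - C₁| = 1 →
      completable δ K₁ K₂ C₀ C₁ V =
        Forb (LabelledCycle.nonMetric δ ∪ LabelledCycle.cCycles δ (min C₀ C₁) ∪
          LabelledCycle.k₁Cycles δ K₁ ∪ LabelledCycle.k₂Cycles δ K₂ (min C₀ C₁)) V) ∧
    (1 < |(C₀ : ℤ) - C₁| → (5 < δ ∨ CaseIII δ K₁ K₂ C₀ C₁) →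
      completable δ K₁ K₂ C₀ C₁ V =
        Forb (LabelledCycle.nonMetric δ ∪ LabelledCycle.c₀Cycles δ C₀ ∪
          LabelledCycle.c₁Cycles δ C₁ ∪
          LabelledCycle.k₁Cycles δ K₁ ∪ LabelledCycle.k₂Cycles δ K₂ (min C₀ C₁)) V) ∧
    (1 < |(C₀ : ℤ) - C₁| → δ = 5 → CaseIIB δ K₁ K₂ C₀ C₁ →
      completable δ K₁ K₂ C₀ C₁ V =
        Forb (LabelledCycle.nonMetric δ ∪ LabelledCycle.c₀Cycles δ C₀ ∪
          LabelledCycle.c₁Cycles δ C₁ ∪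
          LabelledCycle.k₁Cycles δ K₁ ∪ LabelledCycle.k₂Cycles δ K₂ (min C₀ C₁) ∪
          LabelledCycle.fiveFives δ) V) := by
  obtain ⟨hacc, hcase⟩ := hadm
  have gap : 1 < |(C₀ : ℤ) - C₁| → min C₀ C₁ + 1 < max C₀ C₁ := by
    intro h
    rcases lt_abs.1 h with h | h <;> omega
  refine ⟨fun h => ?_, fun h h' => ?_, fun h h5 hIIB => ?_⟩
  · refine completable_eq_forb_of_adjacent ⟨hacc, hcase⟩ ?_
    rcases (abs_eq zero_le_one).1 h with h | h <;> omega
  · by_cases hIII : CaseIII δ K₁ K₂ C₀ C₁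
    · exact completable_eq_forb_of_caseIII hacc hIII (gap h)
    have hδ := h'.resolve_right hIII
    rcases hcase with hIIA | hIIB | hIII'
    · have := hIIA.2
      have := gap h
      omega
    · rw [completable_eq_forb_of_caseIIB hacc hIIB ∅ (Set.empty_subset _) (by simp)
        (fun h => by omega), Set.union_empty]
    · exact absurd hIII' hIII
  · exact completable_eq_forb_of_caseIIB hacc hIIB _ Set.Subset.rfl (fun _ => h5)
      fun _ => Set.Subset.rfl
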